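/- Let $k$ be a field, $d\ge 1$, $\widetilde{\mathcal O}=k[\![t_1]\!]\times\cdots\times k[\![t_d]\!]$, and let $\mathcal O\subseteq\widetilde{\mathcal O}$ be a local $k$-subalgebra of finite codimension (for instance the completed local ring, assumed totally rational, of an algebraic curve over $k$ at a closed point, embedded in its normalization). For $z=(z_1,\dots,z_d)\in\widetilde{\mathcal O}$ put $\underline v(z)=(\operatorname{ord}z_1,\dots,\operatorname{ord}z_d)$, let $S=\{\underline v(z): z\in\mathcal O \text{ a non-zero-divisor}\}\subseteq\mathbb N^d$, and for $\underline m\in\mathbb N^d$ let $J_{\underline m}(\mathcal O)=\{z\in\mathcal O:\underline v(z)\ge\underline m\}$, $l(\underline m)=\dim_k\mathcal O/J_{\underline m}(\mathcal O)$ and $\|\underline m\|=m_1+\dots+m_d$. For $I\subseteq I_0=\{1,\dots,d\}$ let $\underline 1_I\in\mathbb N^d$ be the indicator vector of $I$. For a commutative $k$-algebra $A$ let $\widetilde{\mathcal O}_A=A[\![t_1]\!]\times\cdots\times A[\![t_d]\!]$ and let $\mathcal O_A\subseteq\widetilde{\mathcal O}_A$ be the $t$-adic closure of the $A$-span of $\mathcal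 O$. The functor $A\mapsto\widetilde{\mathcal O}_A^{\times}/\mathcal O_A^{\times}$ on commutative $k$-algebras is represented by a $k$-variety $\mathcal J$ (a separated $k$-scheme of finite type), unique up to unique isomorphism. For $\underline n\in S$, let $\mathcal I_{\underline n}$ be the set of the principal ideals $z\mathcal O$, $z\in\mathcal O$, with $\underline v(z)=\underline n$. It is regarded as a subset of $\mathcal J$ by sending $t^{\underline n}\mu\,\mathcal O$, with $\mu\in\widetilde{\mathcal O}^\times$, to the class of $\mu$; that is, $\mathcal I_{\underline n}$ is identified with the set of those points of $\mathcal J$ which lie under a $K$-point given by the class of some $\mu\in\widetilde{\mathcal O}_K^{\times}$ with $t^{\underline n}\mu\in\mathcal O_K$, for some field extension $K/k$. Then this set is closed in $\mathcal J$, and the class of the resulting reduced closed subvariety in $\mathcal M_k=K_0(\mathrm{Var}_k)[\mathbb L^{-1}]$, where $\mathbb L=[\mathbb A^1_k]$, is $$[\mathcal I_{\underline n}]=(\mathbb L-1)^{-1}\,\mathbb L^{\|\underline n\|+1}\sum_{I\subseteq I_0}(-1)^{\#I}\,\mathbb L^{-l(\underline n+\underline 1_I)} ,$$ where the right-hand side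 denotes $P(\mathbb L)$ for the Laurent polynomial $P\in\mathbb Z[T,T^{-1}]$ with $(T-1)P(T)=T^{\|\underline n\|+1}\sum_{I\subseteq I_0}(-1)^{\#I}\,T^{-l(\underline n+\underline 1_I)}$ (which exists and is unique). -/

import Mathlib

open CategoryTheory AlgebraicGeometry PowerSeries

universe u

namespace CurveSing

/-! ## The Grothendieck ring of varieties -/

/-- An algebraic variety over `k`: a separated scheme of finite type over `k`.
(Nilpotents are allowed; by the scissor relation they do not change the class.) -/
structure Variety (k : Type u) [Field k] where
  X : Over (Spec (CommRingCat.of k))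
  isSeparated : IsSeparated X.hom
  locallyOfFiniteType : LocallyOfFiniteType X.hom
  quasiCompact : QuasiCompact X.hom

/-- The relations of the Grothendieck ring of varieties. -/
inductive Variety.Rel (k : Type u) [Field k] :
    FreeCommRing (Variety k) → FreeCommRing (Variety k) → Prop
  | iso (V W : Variety k) (e : V.X ≅ W.X) :
      Variety.Rel k (FreeCommRing.of V) (FreeCommRing.of W)
  | scissor (V U Z : Variety k) (j : U.X ⟶ V.X) (i : Z.X ⟶ V.X)
      (hj : IsOpenImmersion j.left) (hi : IsClosedImmersion i.left)
      (h : Set.range j.left = (Set.range i.left)ᶜ) :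
      Variety.Rel k (FreeCommRing.of V) (FreeCommRing.of U + FreeCommRing.of Z)
  | prod (V W P : Variety k) (p : P.X.left ⟶ V.X.left) (q : P.X.left ⟶ W.X.left)
      (h : IsPullback p q V.X.hom W.X.hom) (hp : p ≫ V.X.hom = P.X.hom) :
      Variety.Rel k (FreeCommRing.of P) (FreeCommRing.of V * FreeCommRing.of W)
  | point (V : Variety k) (h : IsIso V.X.hom) :
      Variety.Rel k (FreeCommRing.of V) 1

/-- The Grothendieck ring `K₀(Var_k)`. -/
abbrev K₀Var (k : Type u) [Field k] : Type (u + 1) := RingQuot (Variety.Rel k)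

/-- The class of a variety in `K₀(Var_k)`. -/
noncomputable def Variety.cls₀ {k : Type u} [Field k] (V : Variety k) : K₀Var k :=
  RingQuot.mkRingHom (Variety.Rel k) (FreeCommRing.of V)

/-- `Spec A` as a scheme over `k`, for a commutative `k`-algebra `A`. -/
noncomputable def specOver (k : Type u) [Field k] (A : Type u) [CommRing A] [Algebra k A] :
    Over (Spec (CommRingCat.of k)) :=
  Over.mk (Spec.map (CommRingCat.ofHom (algebraMap k A)))

/-- The morphism `Spec B ⟶ Spec A` over `k` induced by a `k`-algebra map `A → B`. -/
noncomputable def specOverMap {k : Type u} [Field k] {A B : Type u} [CommRing A] [Algebra k A]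
    [CommRing B] [Algebra k B] (f : A →ₐ[k] B) : specOver k B ⟶ specOver k A :=
  Over.homMk (Spec.map (CommRingCat.ofHom f.toRingHom)) (by
    simp only [specOver, Over.mk_hom, Over.mk_left]
    rw [← Spec.map_comp, ← CommRingCat.ofHom_comp]
    congr 2
    exact f.comp_algebraMap)

/-- The affine line over `k`. -/
noncomputable def affineLine (k : Type u) [Field k] : Variety k where
  X := specOver k (Polynomial k)
  isSeparated := by dsimp only [specOver, Over.mk_hom]; infer_instance
  locallyOfFiniteType := by
    dsimp only [specOver, Over.mk_hom]
    rw [HasRingHomProperty.Spec_iff (P := @LocallyOfFiniteType)]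
    exact RingHom.finiteType_algebraMap.mpr inferInstance
  quasiCompact := by
    dsimp only [specOver, Over.mk_hom, Over.mk_left]
    exact inferInstanceAs (QuasiCompact (Spec.map (CommRingCat.ofHom (algebraMap k _))))

/-- The ring `M_k = K₀(Var_k)[𝕃⁻¹]`, where `𝕃` is the class of the affine line. -/
abbrev MRing (k : Type u) [Field k] : Type (u + 1) :=
  Localization.Away (affineLine k).cls₀

/-- The class of a variety in `M_k`. -/
noncomputable def Variety.cls {k : Type u} [Field k] (V : Variety k) : MRing k :=
  algebraMap (K₀Var k) (MRing k) V.cls₀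

/-- The class `𝕃` of the affine line as a unit of `M_k`. -/
noncomputable def lefschetz (k : Type u) [Field k] : (MRing k)ˣ :=
  (IsLocalization.Away.algebraMap_isUnit (S := MRing k) (affineLine k).cls₀).unit

/-- A closed subset of a variety, with its reduced scheme structure, as a variety. -/
noncomputable def Variety.ofClosed {k : Type u} [Field k] (V : Variety k)
    (Z : Set V.X.left) (hZ : IsClosed Z) : Variety k where
  X := Over.mk
    ((Scheme.IdealSheafData.vanishingIdeal (X := V.X.left) ⟨Z, hZ⟩).subschemeι ≫ V.X.hom)
  isSeparated := by
    have := V.isSeparated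
    dsimp only [Over.mk_hom]; infer_instance
  locallyOfFiniteType := by
    have := V.locallyOfFiniteType
    dsimp only [Over.mk_hom]; infer_instance
  quasiCompact := by
    have := V.quasiCompact
    dsimp only [Over.mk_hom]; infer_instance

/-! ## The local ring, its values and its filtration -/

section LocalRing

variable {k : Type u} [Field k] {d : ℕ}

/-- The semigroup of values: `n ∈ S` iff some `z ∈ 𝒪` has `v(z) = n`
(such a `z` has all its components nonzero, i.e. it is not a zero divisor). -/
def valueSemigroup (O : Subalgebra k (Fin d → k⟦X⟧)) : Set (Fin d → ℕ) :=
  {n | ∃ z ∈ O, ∀ i, (z i).order = n i}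

/-- The ideal `J_m(𝒪) = {z ∈ 𝒪 | v(z) ≥ m}`. -/
def valIdeal (O : Subalgebra k (Fin d → k⟦X⟧)) (m : Fin d → ℕ) : Ideal O where
  carrier := {z | ∀ i, (m i : ℕ∞) ≤ ((z : Fin d → k⟦X⟧) i).order}
  zero_mem' := by intro i; simp
  add_mem' := by
    intro a b ha hb i
    exact le_trans (le_min (ha i) (hb i)) (PowerSeries.min_order_le_order_add _ _)
  smul_mem' := by
    intro c a ha i
    simp only [smul_eq_mul, MulMemClass.coe_mul, Pi.mul_apply, PowerSeries.order_mul]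
    exact le_trans (ha i) le_add_self

/-- `l(m) = dim_k 𝒪 / J_m(𝒪)`. -/
noncomputable def colength (O : Subalgebra k (Fin d → k⟦X⟧)) (m : Fin d → ℕ) : ℕ :=
  Module.finrank k (O ⧸ valIdeal O m)

/-- `‖n‖ = n₁ + ⋯ + n_d`. -/
def norm₁ (n : Fin d → ℕ) : ℕ := ∑ i, n i

/-- The vector `1_I`. -/
def indicatorVec (I : Finset (Fin d)) : Fin d → ℕ := fun i => if i ∈ I then 1 else 0

end LocalRing

/-! ## Families over a `k`-algebra `A`, and the group `𝒥` -/

section Families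

variable {k : Type u} [Field k] {d : ℕ}

/-- Applying a ring homomorphism to all coefficients: `R⟦t₁⟧ × ⋯ × R⟦t_d⟧ → R'⟦t₁⟧ × ⋯ × R'⟦t_d⟧`. -/
noncomputable def mapCoeff (d : ℕ) {R R' : Type u} [CommRing R] [CommRing R'] (f : R →+* R') :
    (Fin d → R⟦X⟧) →+* (Fin d → R'⟦X⟧) :=
  RingHom.pi fun i => (PowerSeries.map f).comp (Pi.evalRingHom _ i)

theorem mapCoeff_apply {R R' : Type u} [CommRing R] [CommRing R'] (f : R →+* R')
    (z : Fin d → R⟦X⟧) (i : Fin d) : mapCoeff d f z i = PowerSeries.map f (z i) := rfl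

/-- The ring `𝒪_A = 𝒪 ⊗̂ A ⊆ A⟦t₁⟧ × ⋯ × A⟦t_d⟧`: the `t`-adic closure of the `A`-algebra
(equivalently, the `A`-module) generated by `𝒪`. In other words, the tuples of power series with
coefficients in `A` that satisfy the linear equations on coefficients which define `𝒪`. -/
noncomputable def family (O : Subalgebra k (Fin d → k⟦X⟧)) (A : Type u) [CommRing A]
    [Algebra k A] : Subalgebra A (Fin d → A⟦X⟧) where
  carrier := {z | ∀ N : ℕ, ∃ y ∈ Algebra.adjoin A (mapCoeff d (algebraMap k A) '' O),
    ∀ i, (X : A⟦X⟧) ^ N ∣ z i - y i}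
  mul_mem' := by
    intro a b ha hb N
    obtain ⟨y, hy, h1⟩ := ha N
    obtain ⟨w, hw, h2⟩ := hb N
    refine ⟨y * w, mul_mem hy hw, fun i => ?_⟩
    have : (a * b) i - (y * w) i = a i * (b i - w i) + (a i - y i) * w i := by
      simp only [Pi.mul_apply]; ring
    rw [this]
    exact dvd_add (Dvd.dvd.mul_left (h2 i) _) (Dvd.dvd.mul_right (h1 i) _)
  add_mem' := by
    intro a b ha hb N
    obtain ⟨y, hy, h1⟩ := ha N
    obtain ⟨w, hw, h2⟩ := hb N
    refine ⟨y + w, add_mem hy hw, fun i => ?_⟩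
    have : (a + b) i - (y + w) i = (a i - y i) + (b i - w i) := by
      simp only [Pi.add_apply]; ring
    rw [this]
    exact dvd_add (h1 i) (h2 i)
  algebraMap_mem' := by
    intro r N
    exact ⟨algebraMap A _ r, Subalgebra.algebraMap_mem _ r, fun i => by simp⟩

theorem mapCoeff_mem_family (O : Subalgebra k (Fin d → k⟦X⟧)) {A B : Type u} [CommRing A]
    [Algebra k A] [CommRing B] [Algebra k B] (f : A →ₐ[k] B) {z : Fin d → A⟦X⟧}
    (hz : z ∈ family O A) : mapCoeff d f.toRingHom z ∈ family O B := by
  intro N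
  obtain ⟨y, hy, h⟩ := hz N
  refine ⟨mapCoeff d f.toRingHom y, ?_, fun i => ?_⟩
  · clear h
    induction hy using Algebra.adjoin_induction with
    | mem x hx =>
      obtain ⟨w, hw, rfl⟩ := hx
      refine Algebra.subset_adjoin ⟨w, hw, ?_⟩
      funext i
      ext n
      simp [mapCoeff_apply]
    | algebraMap r =>
      have : mapCoeff d f.toRingHom (algebraMap A _ r) = algebraMap B _ (f r) := by
        funext i
        simp [mapCoeff_apply, Pi.algebraMap_apply]
      rw [this]
      exact Subalgebra.algebraMap_mem _ _
    | add x y _ _ hx hy => rw [map_add]; exact add_mem hx hy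
    | mul x y _ _ hx hy => rw [map_mul]; exact mul_mem hx hy
  · have := map_dvd (PowerSeries.map f.toRingHom) (h i)
    simpa [mapCoeff_apply] using this

/-- The subgroup `𝒪_A^×` of `(A⟦t₁⟧ × ⋯ × A⟦t_d⟧)^×`. -/
noncomputable def unitSubgroup (O : Subalgebra k (Fin d → k⟦X⟧)) (A : Type u) [CommRing A]
    [Algebra k A] : Subgroup (Fin d → A⟦X⟧)ˣ :=
  (Units.map ((family O A).val : family O A →* (Fin d → A⟦X⟧))).range

/-- The group of `A`-points of `𝒥`, `(A⟦t₁⟧ × ⋯ × A⟦t_d⟧)^× / 𝒪_A^×`. -/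
abbrev JPoints (O : Subalgebra k (Fin d → k⟦X⟧)) (A : Type u) [CommRing A] [Algebra k A] :
    Type u :=
  (Fin d → A⟦X⟧)ˣ ⧸ unitSubgroup O A

/-- Functoriality of the points of `𝒥`: a `k`-algebra map acts on coefficients. -/
noncomputable def JPoints.map (O : Subalgebra k (Fin d → k⟦X⟧)) {A B : Type u} [CommRing A]
    [Algebra k A] [CommRing B] [Algebra k B] (f : A →ₐ[k] B) : JPoints O A →* JPoints O B :=
  QuotientGroup.map _ _ (Units.map (mapCoeff d f.toRingHom : _ →* (Fin d → B⟦X⟧))) (by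
    rintro _ ⟨w, rfl⟩
    refine ⟨⟨⟨_, mapCoeff_mem_family O f w.1.2⟩, ⟨_, mapCoeff_mem_family O f w⁻¹.1.2⟩,
      ?_, ?_⟩, ?_⟩
    · apply Subtype.ext
      simp only [MulMemClass.coe_mul, OneMemClass.coe_one]
      rw [← map_mul, ← MulMemClass.coe_mul, Units.mul_inv]; simp
    · apply Subtype.ext
      simp only [MulMemClass.coe_mul, OneMemClass.coe_one]
      rw [← map_mul, ← MulMemClass.coe_mul, Units.inv_mul]; simp
    · apply Units.ext
      rfl)

/-- The algebraic variety `𝒥 = 𝒪̃^× / 𝒪^×`: a variety over `k` whose `A`-points, for all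
commutative `k`-algebras `A`, are identified naturally with `JPoints O A`. By Yoneda's lemma it
is unique up to a unique isomorphism. -/
structure JVariety (O : Subalgebra k (Fin d → k⟦X⟧)) where
  V : Variety k
  points : ∀ (A : Type u) [CommRing A] [Algebra k A], (specOver k A ⟶ V.X) ≃ JPoints O A
  natural : ∀ {A B : Type u} [CommRing A] [Algebra k A] [CommRing B] [Algebra k B]
    (f : A →ₐ[k] B) (x : specOver k A ⟶ V.X),
    points B (specOverMap f ≫ x) = JPoints.map O f (points A x)

/-- The tuple `t^n = (t₁^{n₁}, …, t_d^{n_d})`. -/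
noncomputable def tPow (A : Type u) [CommRing A] (n : Fin d → ℕ) : Fin d → A⟦X⟧ :=
  fun i => X ^ n i

/-- The set `ℐ_n` of the principal ideals `z𝒪_K` of `𝒪_K` with `v(z) = n`, over an extension
field `K` of `k`. -/
def principalIdeals (O : Subalgebra k (Fin d → k⟦X⟧)) (n : Fin d → ℕ) (K : Type u) [Field K]
    [Algebra k K] : Set (Ideal (family O K)) :=
  {I | ∃ z : family O K, (∀ i, ((z : Fin d → K⟦X⟧) i).order = n i) ∧ I = Ideal.span {z}}

/-- The graph of `σ_n : ℐ_n → 𝒥(K)`, which sends the ideal `t^n μ 𝒪_K` to the class of `μ`. -/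
def IsSigma (O : Subalgebra k (Fin d → k⟦X⟧)) (n : Fin d → ℕ) (K : Type u) [Field K]
    [Algebra k K] (I : Ideal (family O K)) (q : JPoints O K) : Prop :=
  ∃ (μ : (Fin d → K⟦X⟧)ˣ) (z : family O K), (z : Fin d → K⟦X⟧) = tPow K n * (μ : Fin d → K⟦X⟧) ∧
    I = Ideal.span {z} ∧ q = QuotientGroup.mk μ

/-- The subset `σ_n(ℐ_n)` of the variety `𝒥`, which is identified with `ℐ_n`: the points of `𝒥`
below the `K`-points in `σ_n(ℐ_n)`, for all extension fields `K` of `k`. -/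
def sigmaImage {O : Subalgebra k (Fin d → k⟦X⟧)} (J : JVariety O) (n : Fin d → ℕ) :
    Set J.V.X.left :=
  {x | ∃ (K : Type u) (_ : Field K) (_ : Algebra k K) (p : specOver k K ⟶ J.V.X)
    (I : Ideal (family O K)), I ∈ principalIdeals O n K ∧ IsSigma O n K I (J.points K p) ∧
      x ∈ Set.range p.left}

end Families

end CurveSing

/-! Finite codimension gives an `N` with `t^N 𝒪̃ ⊆ 𝒪`, so membership in `𝒪_A` is a system of
`k`-linear equations on jets of order `< N`. A projection `p` of the jet space, with kernel the jets
of `𝒪` and respecting the `t`-adic filtration (`exists_jetSplitting`), provides a complement of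
`𝒪_A` for all `A` at once.

On tuples `u` without constant terms, `u ↦ (1 + p(u))(1 + u - p(u))` is bijective modulo `t^N`,
because its nonlinear part is contracting. Since `𝒪` is local, elements of `𝒪_A` have equal constant
terms. Hence every class of `𝒥(A)` contains exactly one normal form `x(1 + s)`, with `x` constant,
`x_{i₀} = 1`, and `s` in the complement without constant terms (`exists_normalForm`,
`normalForm_unique`). So `𝒥` is affine, and `ℐ_n` is the closed locus of normal forms `μ` with `t^n
μ ∈ 𝒪_A`.

Multiplying these `μ` by `1 + m`, where `m` runs through the affine space of jets of the maximal
ideal, of dimension `h`, gives bijectively all jets `μ` with `t^n μ ∈ 𝒪_A`, `μ_{i₀}(0) = 1` and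
`μ(0)` invertible (`bijOn_mul`). This is a hyperplane complement in a linear system, and
inclusion-exclusion over `I ⊆ I₀ \ {i₀}` computes its class, which is `[ℐ_n] 𝕃^h`.

Let `D(I)` be the dimension of the jets `μ` with `t^n μ ∈ 𝒪` and `μ_i(0) = 0` for `i ∈ I`. Counting
dimensions gives `D(I) - h = ‖n‖ + 1 - l(n + 1_I)` (`finrank_jetSpace`, `colength_maximal`). The
term of `I` is an affine space of dimension `D(I ∪ {i₀})` if `D(I) = D(I ∪ {i₀}) + 1`, and is empty
if the two dimensions agree. In both cases `𝕃 - 1` times its class is `𝕃^{D(I)} - 𝕃^{D(I ∪ {i₀})}`,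
and this pairing of `I` with `I ∪ {i₀}` is the division by `T - 1` in the formula. -/

namespace CurveSing

/-! ### Classes of affine varieties in the Grothendieck ring -/

section AffineClasses

variable {k : Type u} [Field k]

/-- An affine variety, given by its coordinate ring. -/
noncomputable def affVar (k : Type u) [Field k] (B : Type u) [CommRing B] [Algebra k B]
    [Algebra.FiniteType k B] : Variety k where
  X := specOver k B
  isSeparated := by dsimp only [specOver, Over.mk_hom]; infer_instance
  locallyOfFiniteType := by
    dsimp only [specOver, Over.mk_hom]
    rw [HasRingHomProperty.Spec_iff (P := @LocallyOfFiniteType)]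
    exact RingHom.finiteType_algebraMap.mpr inferInstance
  quasiCompact := by
    dsimp only [specOver, Over.mk_hom, Over.mk_left]
    exact inferInstanceAs (QuasiCompact (Spec.map (CommRingCat.ofHom (algebraMap k _))))

theorem cls₀_eq_of_iso {V W : Variety k} (e : V.X ≅ W.X) : V.cls₀ = W.cls₀ :=
  RingQuot.mkRingHom_rel (Variety.Rel.iso V W e)

theorem cls₀_scissor {V U Z : Variety k} (j : U.X ⟶ V.X) (i : Z.X ⟶ V.X)
    [hj : IsOpenImmersion j.left] [hi : IsClosedImmersion i.left]
    (h : Set.range j.left = (Set.range i.left)ᶜ) : V.cls₀ = U.cls₀ + Z.cls₀ := by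
  have := RingQuot.mkRingHom_rel (Variety.Rel.scissor V U Z j i hj hi h)
  rwa [map_add] at this

variable {B C : Type u} [CommRing B] [Algebra k B] [CommRing C] [Algebra k C]

theorem specOverMap_comp {D : Type u} [CommRing D] [Algebra k D] (f : B →ₐ[k] C) (g : C →ₐ[k] D) :
    specOverMap (g.comp f) = specOverMap g ≫ specOverMap f := by
  ext : 1
  exact Spec.map_comp (CommRingCat.ofHom f.toRingHom) (CommRingCat.ofHom g.toRingHom)

theorem specOverMap_id : specOverMap (AlgHom.id k B) = 𝟙 _ := by
  ext : 1
  exact Spec.map_id _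

/-- The morphisms between affine schemes over `k` are the algebra maps. -/
noncomputable def specOverEquiv : (specOver k C ⟶ specOver k B) ≃ (B →ₐ[k] C) where
  toFun x := { (Spec.preimage x.left).hom with
    commutes' := fun r => by
      have h := Over.w x
      have h2 : CommRingCat.ofHom (algebraMap k B) ≫ Spec.preimage x.left =
          CommRingCat.ofHom (algebraMap k C) := by
        apply Spec.map_injective
        refine (Spec.map_comp _ _).trans (Eq.trans ?_ h)
        exact congr($(Spec.map_preimage x.left) ≫ (specOver k B).hom)
      exact congr($(h2).hom r) }
  invFun f := specOverMap f
  left_inv x := by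
    ext : 1
    exact Spec.map_preimage x.left
  right_inv f := by
    ext r
    have : Spec.preimage (specOverMap f).left = CommRingCat.ofHom f.toRingHom :=
      Spec.preimage_map _
    exact congr($(this).hom r)

theorem specOverEquiv_symm_apply (f : B →ₐ[k] C) : specOverEquiv.symm f = specOverMap f := rfl

theorem specOverEquiv_comp {D : Type u} [CommRing D] [Algebra k D]
    (f : C →ₐ[k] D) (x : specOver k C ⟶ specOver k B) :
    specOverEquiv (specOverMap f ≫ x) = f.comp (specOverEquiv x) := by
  obtain ⟨g, rfl⟩ := specOverEquiv.symm.surjective x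
  rw [specOverEquiv_symm_apply, ← specOverMap_comp, ← specOverEquiv_symm_apply,
    Equiv.apply_symm_apply, ← specOverEquiv_symm_apply, Equiv.apply_symm_apply]

theorem specOverMap_left_isClosedImmersion (f : B →ₐ[k] C) (hf : Function.Surjective f) :
    IsClosedImmersion (specOverMap f).left :=
  IsClosedImmersion.spec_of_surjective _ hf

theorem range_specOverMap_left (f : B →ₐ[k] C) :
    Set.range (specOverMap f).left = Set.range (PrimeSpectrum.comap f.toRingHom) := rfl

variable [Algebra.FiniteType k B] [Algebra.FiniteType k C]

theorem affVar_cls₀_congr (e : B ≃ₐ[k] C) : (affVar k B).cls₀ = (affVar k C).cls₀ :=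
  cls₀_eq_of_iso (V := affVar k B) (W := affVar k C)
    { hom := specOverMap e.symm.toAlgHom
      inv := specOverMap e.toAlgHom
      hom_inv_id := by
        refine (specOverMap_comp _ _).symm.trans (Eq.trans ?_ specOverMap_id)
        congr 1; ext; simp
      inv_hom_id := by
        refine (specOverMap_comp _ _).symm.trans (Eq.trans ?_ specOverMap_id)
        congr 1; ext; simp }

theorem affVar_cls₀_self : (affVar k k).cls₀ = 1 := by
  have h : IsIso (affVar k k).X.hom := by
    have : (affVar k k).X.hom = 𝟙 _ := Spec.map_id _
    rw [this]; exact IsIso.id _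
  have := RingQuot.mkRingHom_rel (Variety.Rel.point (affVar k k) h)
  rwa [map_one] at this

theorem affVar_cls₀_polynomial : (affVar k (Polynomial k)).cls₀ = (affineLine k).cls₀ := rfl

instance finiteType_tensorProduct : Algebra.FiniteType k (TensorProduct k B C) :=
  Algebra.FiniteType.trans (S := B) inferInstance inferInstance

open TensorProduct in
theorem affVar_cls₀_tensor :
    (affVar k (B ⊗[k] C)).cls₀ = (affVar k B).cls₀ * (affVar k C).cls₀ := by
  have h := isPullback_SpecMap_of_isPushout _ _ _ _ (CommRingCat.isPushout_tensorProduct k B C)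
  have hp : Spec.map (CommRingCat.ofHom (Algebra.TensorProduct.includeLeftRingHom (R := k)
      (A := B) (B := C))) ≫ (affVar k B).X.hom =
      (affVar k (B ⊗[k] C)).X.hom := by
    exact Over.w (specOverMap (Algebra.TensorProduct.includeLeft : B →ₐ[k] B ⊗[k] C))
  have := RingQuot.mkRingHom_rel (Variety.Rel.prod (affVar k B) (affVar k C) (affVar k (B ⊗[k] C))
    _ _ h hp)
  rwa [map_mul] at this

theorem affVar_cls₀_scissor (b : B) :
    (affVar k B).cls₀ = (affVar k (Localization.Away b)).cls₀ +
      (affVar k (B ⧸ Ideal.span {b})).cls₀ := by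
  let j : B →ₐ[k] Localization.Away b := IsScalarTower.toAlgHom k B _
  let i : B →ₐ[k] B ⧸ Ideal.span {b} := Ideal.Quotient.mkₐ k _
  have h1 : IsOpenImmersion (specOverMap j).left :=
    Scheme.isOpenImmersion_SpecMap_localizationAway (R := .of B) b
  have h2 := specOverMap_left_isClosedImmersion i Ideal.Quotient.mk_surjective
  have hr : Set.range (PrimeSpectrum.comap j.toRingHom) =
      (Set.range (PrimeSpectrum.comap i.toRingHom))ᶜ := by
    rw [show j.toRingHom = algebraMap B (Localization.Away b) from rfl,
      PrimeSpectrum.localization_away_comap_range _ b,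
      range_comap_of_surjective _ i.toRingHom Ideal.Quotient.mk_surjective]
    have : RingHom.ker i.toRingHom = Ideal.span {b} := Ideal.mk_ker
    rw [this, PrimeSpectrum.zeroLocus_span, PrimeSpectrum.basicOpen_eq_zeroLocus_compl]
  exact cls₀_scissor (V := affVar k B) (U := affVar k _) (Z := affVar k _)
    (specOverMap j) (specOverMap i) (hj := h1) (hi := h2) hr

/-- Cutting the empty scheme along the function `1` leaves two empty pieces, so its class `c`
satisfies `c = c + c`. -/
theorem affVar_cls₀_of_subsingleton [Subsingleton B] : (affVar k B).cls₀ = 0 := by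
  have h := affVar_cls₀_scissor (k := k) (1 : B)
  have e1 : Subsingleton (B ⧸ Ideal.span {(1 : B)}) := inferInstance
  have e2 : Subsingleton (Localization.Away (1 : B)) :=
    ⟨fun a b => (IsLocalization.atOne B (Localization.Away (1 : B))).symm.injective
      (Subsingleton.elim _ _)⟩
  have e1' : B ≃ₐ[k] (B ⧸ Ideal.span {(1 : B)}) :=
    AlgEquiv.ofBijective (Ideal.Quotient.mkₐ k _)
      ⟨fun _ _ _ => Subsingleton.elim _ _, Ideal.Quotient.mk_surjective⟩
  have e2' : B ≃ₐ[k] (Localization.Away (1 : B)) :=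
    AlgEquiv.ofBijective (IsScalarTower.toAlgHom k B _)
      ⟨fun _ _ _ => Subsingleton.elim _ _, fun x => ⟨0, Subsingleton.elim _ _⟩⟩
  rw [← affVar_cls₀_congr e1', ← affVar_cls₀_congr e2'] at h
  simpa using h

end AffineClasses

/-! ### Closed subsets, and isomorphisms detected on affine test schemes -/

section Closed
variable {k : Type u} [Field k]

/-- The open subvariety on an open subset. -/
noncomputable def Variety.ofOpen (V : Variety k) (U : V.X.left.Opens) : Variety k where
  X := Over.mk (U.ι ≫ V.X.hom)
  isSeparated := by
    have := V.isSeparated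
    dsimp only [Over.mk_hom]; infer_instance
  locallyOfFiniteType := by
    have := V.locallyOfFiniteType
    dsimp only [Over.mk_hom]; infer_instance
  quasiCompact := by
    have := V.quasiCompact
    have := V.locallyOfFiniteType
    dsimp only [Over.mk_hom]
    have : IsLocallyNoetherian V.X.left := LocallyOfFiniteType.isLocallyNoetherian V.X.hom
    infer_instance

/-- Two closed subschemes with the same support have the same open complement, so the scissor
relation equates their classes. This replaces the reduced structure by whatever scheme structure the
equations give. -/
theorem ofClosed_cls₀_eq {V W : Variety k} (i : W.X ⟶ V.X) [IsClosedImmersion i.left]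
    {Z : Set V.X.left} (hZ : IsClosed Z) (h : Set.range i.left = Z) :
    (V.ofClosed Z hZ).cls₀ = W.cls₀ := by
  let U : V.X.left.Opens := ⟨Zᶜ, hZ.isOpen_compl⟩
  let j : (V.ofOpen U).X ⟶ V.X := Over.homMk U.ι rfl
  let i' : (V.ofClosed Z hZ).X ⟶ V.X := Over.homMk
    (Scheme.IdealSheafData.vanishingIdeal (X := V.X.left) ⟨Z, hZ⟩).subschemeι rfl
  have hj : IsOpenImmersion j.left := inferInstanceAs (IsOpenImmersion U.ι)
  have hi' : IsClosedImmersion i'.left := inferInstanceAs (IsClosedImmersion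
    (Scheme.IdealSheafData.vanishingIdeal (X := V.X.left) ⟨Z, hZ⟩).subschemeι)
  have hjr : Set.range j.left = Zᶜ := Scheme.Opens.range_ι U
  have hir : Set.range i'.left = Z := by
    refine (Scheme.IdealSheafData.range_subschemeι _).trans ?_
    simp
  have h1 := cls₀_scissor j i (by rw [hjr, h])
  have h2 := cls₀_scissor j i' (by rw [hjr, hir])
  exact add_left_cancel (h2.symm.trans h1)

/-- An affine scheme over `k` whose functor of points agrees, through `f`, with that of `X` on
affine schemes is isomorphic to `X`. -/
theorem isIso_of_bijective_points {B : Type u} [CommRing B] [Algebra k B]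
    {X : Over (Spec (CommRingCat.of k))} (f : specOver k B ⟶ X)
    (hf : ∀ (A : Type u) [CommRing A] [Algebra k A] (x : specOver k A ⟶ X),
      ∃! φ : B →ₐ[k] A, specOverMap φ ≫ f = x) : IsIso f := by
  have key : ∀ (A : Type u) [CommRing A] [Algebra k A] (x : specOver k A ⟶ X),
      ∃! g : specOver k A ⟶ specOver k B, g ≫ f = x := by
    intro A _ _ x
    obtain ⟨φ, h1, h2⟩ := hf A x
    refine ⟨specOverMap φ, h1, fun g hg => ?_⟩
    obtain ⟨ψ, rfl⟩ := specOverEquiv.symm.surjective g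
    rw [h2 ψ hg]; rfl
  have key' : ∀ (R : CommRingCat.{u}) (x : Spec R ⟶ X.left),
      ∃! g : Spec R ⟶ (specOver k B).left, g ≫ f.left = x := by
    intro R x
    -- Any morphism from an affine scheme to `X` makes its ring a `k`-algebra, so the hypothesis
    -- over `k` covers absolute morphisms too.
    let _ : Algebra k R := (Spec.preimage (x ≫ X.hom)).hom.toAlgebra
    have hk : (specOver k R).hom = x ≫ X.hom := Spec.map_preimage (x ≫ X.hom)
    obtain ⟨g, h1, h2⟩ := key R (Over.homMk x hk.symm)
    refine ⟨g.left, congr($(h1).left), fun g' hg' => ?_⟩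
    have hw : g' ≫ (specOver k B).hom = (specOver k R).hom := by
      rw [hk, ← hg', Category.assoc, Over.w f]
    have := h2 (Over.homMk g' hw) (by ext : 1; exact hg')
    exact congr($(this).left)
  have key'' : ∀ (T : Scheme.{u}) (i : T.affineCover.I₀) (x : T.affineCover.X i ⟶ X.left),
      ∃! g : T.affineCover.X i ⟶ (specOver k B).left, g ≫ f.left = x := fun T i x => key' _ x
  have hmono : Mono f.left := by
    refine ⟨fun {T} a b hab => ?_⟩
    refine Scheme.Cover.hom_ext T.affineCover _ _ fun i => ?_
    obtain ⟨g, -, h2⟩ := key'' T i (T.affineCover.f i ≫ a ≫ f.left)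
    rw [h2 (T.affineCover.f i ≫ a) (by simp), h2 (T.affineCover.f i ≫ b) (by simp [hab])]
  -- The inverse is glued from the unique lifts of an affine cover of `X`; they agree on overlaps
  -- because `f` is a monomorphism.
  choose g hg _ using fun i => key'' _ i (X.left.affineCover.f i)
  have hcompat : ∀ x y, Limits.pullback.fst (X.left.affineCover.f x) (X.left.affineCover.f y) ≫ g x
      = Limits.pullback.snd _ _ ≫ g y := by
    intro x y
    rw [← cancel_mono f.left, Category.assoc, Category.assoc, hg, hg, Limits.pullback.condition]
  have hs : X.left.affineCover.glueMorphisms g hcompat ≫ f.left = 𝟙 _ := by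
    refine Scheme.Cover.hom_ext X.left.affineCover _ _ fun i => ?_
    rw [← Category.assoc, Scheme.Cover.ι_glueMorphisms, hg, Category.comp_id]
  have : IsIso f.left := by
    refine ⟨X.left.affineCover.glueMorphisms g hcompat, ?_, hs⟩
    rw [← cancel_mono f.left, Category.assoc, hs, Category.comp_id, Category.id_comp]
  have : IsIso ((Over.forget _).map f) := this
  exact isIso_of_reflects_iso f (Over.forget _)

end Closed
end CurveSing

namespace CurveSing

/-! ### Functors of points in coordinates and their classes -/

section Points

variable {k : Type u} [Field k]

/-- A family of subsets `X A ⊆ A^E`, for all commutative `k`-algebras `A`. -/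
abbrev PointSet (k : Type u) [Field k] (E : Type) :=
  ∀ (A : Type u) [CommRing A] [Algebra k A], Set (E → A)

/-- The point `b` of `X` over `B` is universal: the algebra `B` represents the functor `X`. -/
structure Represents {E : Type} (X : PointSet k E) (B : Type u) [CommRing B] [Algebra k B]
    (b : E → B) : Prop where
  mem : ∀ (A : Type u) [CommRing A] [Algebra k A] (φ : B →ₐ[k] A), (fun e => φ (b e)) ∈ X A
  exists_lift : ∀ (A : Type u) [CommRing A] [Algebra k A] (v : E → A), v ∈ X A →
    ∃ φ : B →ₐ[k] A, ∀ e, φ (b e) = v e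
  unique : ∀ (A : Type u) [CommRing A] [Algebra k A] (φ ψ : B →ₐ[k] A),
    (∀ e, φ (b e) = ψ (b e)) → φ = ψ

/-- The functor `X` is represented by an affine variety of class `c`. -/
def HasClass {E : Type} (X : PointSet k E) (c : K₀Var k) : Prop :=
  ∃ (B : Type u) (_ : CommRing B) (_ : Algebra k B) (_ : Algebra.FiniteType k B) (b : E → B),
    Represents X B b ∧ (affVar k B).cls₀ = c

/-- A family of maps `A^E → A^E'` is natural on the points of `X`. -/
def IsNaturalOn {E E' : Type} (X : PointSet k E)
    (α : ∀ (A : Type u) [CommRing A] [Algebra k A], (E → A) → (E' → A)) : Prop :=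
  ∀ (A A' : Type u) [CommRing A] [Algebra k A] [CommRing A'] [Algebra k A'] (φ : A →ₐ[k] A')
    (v : E → A), v ∈ X A → α A' (fun e => φ (v e)) = fun e => φ (α A v e)

variable {E E' : Type} {X : PointSet k E} {Y : PointSet k E'}

theorem Represents.mem_self {B : Type u} [CommRing B] [Algebra k B] {b : E → B}
    (h : Represents X B b) : b ∈ X B := h.mem B (AlgHom.id k B)

/-- By Yoneda, a natural bijection of functors carries the universal point to a universal point over
the same algebra. Isomorphisms of varieties can thus be built from bijections of sets, checked over
every `A`. -/
theorem Represents.map {B : Type u} [CommRing B] [Algebra k B] {b : E → B}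
    (h : Represents X B b)
    (α : ∀ (A : Type u) [CommRing A] [Algebra k A], (E → A) → (E' → A)) (hα : IsNaturalOn X α)
    (hbij : ∀ (A : Type u) [CommRing A] [Algebra k A], Set.BijOn (α A) (X A) (Y A)) :
    Represents Y B (α B b) where
  mem A _ _ φ := by
    rw [← hα B A φ b h.mem_self]
    exact (hbij A).mapsTo (h.mem A φ)
  exists_lift A _ _ v hv := by
    obtain ⟨w, hw, rfl⟩ := (hbij A).surjOn hv
    obtain ⟨φ, hφ⟩ := h.exists_lift A w hw
    refine ⟨φ, fun e => ?_⟩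
    rw [← funext hφ, hα B A φ b h.mem_self]
  unique A _ _ φ ψ hφψ := by
    refine h.unique A φ ψ fun e => ?_
    refine congrFun ((hbij A).injOn (h.mem A φ) (h.mem A ψ) ?_) e
    rw [hα B A φ b h.mem_self, hα B A ψ b h.mem_self]
    exact funext hφψ

theorem HasClass.map {c : K₀Var k} (h : HasClass X c)
    (α : ∀ (A : Type u) [CommRing A] [Algebra k A], (E → A) → (E' → A)) (hα : IsNaturalOn X α)
    (hbij : ∀ (A : Type u) [CommRing A] [Algebra k A], Set.BijOn (α A) (X A) (Y A)) :
    HasClass Y c := by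
  obtain ⟨B, _, _, _, b, hb, hc⟩ := h
  exact ⟨B, _, _, ‹_›, _, hb.map α hα hbij, hc⟩

theorem HasClass.congr {X' : PointSet k E} {c : K₀Var k} (h : HasClass X c)
    (hX : ∀ (A : Type u) [CommRing A] [Algebra k A], X A = X' A) : HasClass X' c :=
  h.map (fun _ _ _ v => v) (fun _ _ _ _ _ _ _ _ _ => rfl)
    fun A _ _ => by rw [hX A]; exact Set.bijOn_id _

/-- The universal points lift to mutually inverse algebra maps, so a functor determines its class.
-/
theorem HasClass.unique {c c' : K₀Var k} (h : HasClass X c) (h' : HasClass X c') : c = c' := by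
  obtain ⟨B, _, _, _, b, hb, rfl⟩ := h
  obtain ⟨C, _, _, _, b', hb', rfl⟩ := h'
  obtain ⟨φ, hφ⟩ := hb.exists_lift C b' hb'.mem_self
  obtain ⟨ψ, hψ⟩ := hb'.exists_lift B b hb.mem_self
  exact affVar_cls₀_congr (AlgEquiv.ofAlgHom φ ψ
    (hb'.unique _ _ _ fun e => by simp [hφ, hψ]) (hb.unique _ _ _ fun e => by simp [hφ, hψ]))

open TensorProduct in
theorem HasClass.prod {c c' : K₀Var k} (h : HasClass X c) (h' : HasClass Y c') :
    HasClass (k := k) (E := E ⊕ E')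
      (fun A _ _ => {v | (fun e => v (.inl e)) ∈ X A ∧ (fun e => v (.inr e)) ∈ Y A}) (c * c') := by
  obtain ⟨B, _, _, _, b, hb, rfl⟩ := h
  obtain ⟨C, _, _, _, b', hb', rfl⟩ := h'
  refine ⟨B ⊗[k] C, _, _, inferInstance,
    Sum.elim (fun e => b e ⊗ₜ[k] 1) (fun e => 1 ⊗ₜ[k] b' e), ?_, affVar_cls₀_tensor⟩
  constructor
  · intro A _ _ φ
    exact ⟨hb.mem A (φ.comp Algebra.TensorProduct.includeLeft),
      hb'.mem A (φ.comp Algebra.TensorProduct.includeRight)⟩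
  · rintro A _ _ v ⟨h1, h2⟩
    obtain ⟨φ, hφ⟩ := hb.exists_lift A _ h1
    obtain ⟨ψ, hψ⟩ := hb'.exists_lift A _ h2
    refine ⟨Algebra.TensorProduct.productMap φ ψ, ?_⟩
    rintro (e | e) <;> simp [hφ, hψ]
  · intro A _ _ φ ψ hφψ
    apply Algebra.TensorProduct.ext'
    intro x y
    have h1 := DFunLike.congr_fun (hb.unique A (φ.comp Algebra.TensorProduct.includeLeft)
      (ψ.comp Algebra.TensorProduct.includeLeft) fun e => hφψ (.inl e)) x
    have h2 := DFunLike.congr_fun (hb'.unique A (φ.comp Algebra.TensorProduct.includeRight)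
      (ψ.comp Algebra.TensorProduct.includeRight) fun e => hφψ (.inr e)) y
    have : x ⊗ₜ[k] y = (x ⊗ₜ[k] 1) * (1 ⊗ₜ[k] y) := by simp
    rw [this, map_mul, map_mul]
    exact congr_arg₂ _ h1 h2

theorem Represents.vanishing {B : Type u} [CommRing B] [Algebra k B] {b : E → B}
    (h : Represents X B b)
    (f : ∀ (A : Type u) [CommRing A] [Algebra k A], (E → A) → (E' → A)) (hf : IsNaturalOn X f) :
    Represents (k := k) (fun A _ _ => {v | v ∈ X A ∧ ∀ e, f A v e = 0})
      (B ⧸ Ideal.span (Set.range (f B b))) (fun e => Ideal.Quotient.mk _ (b e)) where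
  mem A _ _ φ := by
    let π := Ideal.Quotient.mkₐ k (Ideal.span (Set.range (f B b)))
    refine ⟨h.mem A (φ.comp π), fun e => ?_⟩
    have := congrFun (hf B A (φ.comp π) b h.mem_self) e
    refine this.trans ?_
    have h0 : π (f B b e) = 0 :=
      Ideal.Quotient.eq_zero_iff_mem.mpr (Ideal.subset_span ⟨e, rfl⟩)
    simp [h0]
  exists_lift A _ _ v hv := by
    obtain ⟨φ, hφ⟩ := h.exists_lift A v hv.1
    refine ⟨Ideal.Quotient.liftₐ _ φ fun x hx => ?_, fun e => ?_⟩
    · have : Ideal.span (Set.range (f B b)) ≤ RingHom.ker φ := by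
        rw [Ideal.span_le]
        rintro _ ⟨e, rfl⟩
        have := congrFun (hf B A φ b h.mem_self) e
        rw [funext hφ, hv.2 e] at this
        exact this.symm
      exact this hx
    · exact (Ideal.Quotient.liftₐ_apply _ _ _ _).trans (hφ e)
  unique A _ _ φ ψ hφψ := by
    apply Ideal.Quotient.algHom_ext
    exact h.unique A _ _ hφψ

theorem Represents.isUnit {B : Type u} [CommRing B] [Algebra k B] {b : E → B}
    (h : Represents X B b) (e₀ : E) :
    Represents (k := k) (fun A _ _ => {v | v ∈ X A ∧ IsUnit (v e₀)})
      (Localization.Away (b e₀)) (fun e => algebraMap B _ (b e)) where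
  mem A _ _ φ :=
    ⟨h.mem A (φ.comp (IsScalarTower.toAlgHom k B (Localization.Away (b e₀)))),
      (IsLocalization.Away.algebraMap_isUnit (b e₀)).map φ⟩
  exists_lift A _ _ v hv := by
    obtain ⟨φ, hφ⟩ := h.exists_lift A v hv.1
    have hu : ∀ y : Submonoid.powers (b e₀), IsUnit (φ y) := by
      rintro ⟨_, n, rfl⟩
      rw [map_pow, hφ]
      exact hv.2.pow n
    refine ⟨IsLocalization.liftAlgHom (M := Submonoid.powers (b e₀)) (f := φ) hu, fun e => ?_⟩
    simp [hφ]
  unique A _ _ φ ψ hφψ := by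
    exact IsLocalization.algHom_ext (W := Submonoid.powers (b e₀)) (h.unique A _ _ hφψ)

/-- Scissor relation for the coordinate `e₀`: the open piece is a localization, and the closed piece
is the quotient by that coordinate. -/
theorem HasClass.isUnit {c c₀ : K₀Var k} {e₀ : E} (h : HasClass X c)
    (h₀ : HasClass (k := k) (fun A _ _ => {v | v ∈ X A ∧ v e₀ = 0}) c₀) :
    HasClass (k := k) (fun A _ _ => {v | v ∈ X A ∧ IsUnit (v e₀)}) (c - c₀) := by
  obtain ⟨B, _, _, _, b, hb, rfl⟩ := h
  have ft : Algebra.FiniteType k (Localization.Away (b e₀)) :=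
    Algebra.FiniteType.trans (S := B) inferInstance
      (IsLocalization.finiteType_of_monoid_fg (Submonoid.powers (b e₀)) _)
  refine ⟨_, _, _, ft, _, hb.isUnit e₀, ?_⟩
  have h1 : HasClass (k := k) (fun A _ _ => {v | v ∈ X A ∧ v e₀ = 0})
      (affVar k (B ⧸ Ideal.span {b e₀})).cls₀ := by
    have := hb.vanishing (E' := Unit) (fun A _ _ v _ => v e₀) (fun _ _ _ _ _ _ _ _ _ => rfl)
    rw [Set.range_const] at this
    refine HasClass.congr ⟨_, _, _, inferInstance, _, this, rfl⟩ fun A _ _ => ?_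
    simp
  rw [h₀.unique h1, affVar_cls₀_scissor (b e₀), add_sub_cancel_right]

/-- The empty scheme has points over the zero ring, so emptiness of a functor means having points
over the zero ring only. -/
theorem HasClass.of_empty (hX : ∀ (A : Type u) [CommRing A] [Algebra k A],
    (X A).Nonempty ↔ Subsingleton A) : HasClass X 0 := by
  refine ⟨PUnit, inferInstance, inferInstance, inferInstance, fun _ => 0, ?_,
    affVar_cls₀_of_subsingleton⟩
  constructor
  · intro A _ _ φ
    have h01 : (0 : A) = 1 := by rw [← map_zero φ, ← map_one φ]
    have : Subsingleton A := subsingleton_of_zero_eq_one h01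
    obtain ⟨v, hv⟩ := (hX A).mpr this
    convert hv
  · intro A _ _ v hv
    have : Subsingleton A := (hX A).mp ⟨v, hv⟩
    exact ⟨{ toFun := fun _ => 0
             map_one' := Subsingleton.elim _ _
             map_mul' := fun _ _ => Subsingleton.elim _ _
             map_zero' := rfl
             map_add' := fun _ _ => Subsingleton.elim _ _
             commutes' := fun _ => Subsingleton.elim _ _ }, fun _ => Subsingleton.elim _ _⟩
  · intro A _ _ φ ψ _
    ext x
    rw [Subsingleton.elim x 0, map_zero, map_zero]

theorem represents_univ (E : Type) :
    Represents (k := k) (E := E) (fun _ _ _ => Set.univ) (MvPolynomial E k) MvPolynomial.X where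
  mem _ _ _ _ := trivial
  exists_lift A _ _ v _ := ⟨MvPolynomial.aeval v, fun e => by simp⟩
  unique _ _ _ _ _ h := MvPolynomial.algHom_ext h

theorem hasClass_univ (n : ℕ) :
    HasClass (k := k) (E := Fin n) (fun _ _ _ => Set.univ) ((affineLine k).cls₀ ^ n) := by
  induction n with
  | zero =>
    refine ⟨k, _, _, inferInstance, Fin.elim0, ⟨fun _ _ _ _ => trivial,
      fun A _ _ v _ => ⟨Algebra.ofId k A, fun e => e.elim0⟩,
      fun A _ _ φ ψ _ => Subsingleton.elim _ _⟩, ?_⟩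
    rw [pow_zero, affVar_cls₀_self]
  | succ n ih =>
    have h1 : HasClass (k := k) (E := Unit) (fun _ _ _ => Set.univ) (affineLine k).cls₀ := by
      refine ⟨Polynomial k, _, _, inferInstance, fun _ => Polynomial.X, ⟨fun _ _ _ _ => trivial,
        fun A _ _ v _ => ⟨Polynomial.aeval (v ()), fun e => by simp⟩,
        fun A _ _ φ ψ h => Polynomial.algHom_ext (h ())⟩, affVar_cls₀_polynomial⟩
    rw [pow_succ]
    refine (ih.prod h1).map (fun A _ _ v => Fin.snoc (fun i => v (.inl i)) (v (.inr ()))) ?_ ?_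
    · intro A A' _ _ _ _ φ v _
      funext i
      refine Fin.lastCases ?_ (fun i => ?_) i <;> simp
    · intro A _ _
      refine ⟨fun _ _ => trivial, ?_, ?_⟩
      · intro v _ w _ hvw
        funext e
        rcases e with e | e
        · simpa using congrFun hvw e.castSucc
        · simpa using congrFun hvw (Fin.last n)
      · intro v _
        refine ⟨Sum.elim (fun i => v i.castSucc) (fun _ => v (Fin.last n)),
          ⟨trivial, trivial⟩, ?_⟩
        funext i
        refine Fin.lastCases ?_ (fun i => ?_) i <;> simp

end Points
end CurveSing

namespace CurveSing

/-! ### Linear systems with constant coefficients and hyperplane complements -/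

section LinearSystems

variable {k : Type u} [Field k] {E E' E'' : Type}
  [Fintype E] [DecidableEq E] [Fintype E'] [DecidableEq E']

/-- Extension of scalars of a linear map between coordinate spaces. -/
noncomputable def extendScalars (A : Type u) [CommRing A] [Algebra k A]
    (f : (E → k) →ₗ[k] (E'' → k)) : (E → A) →ₗ[A] (E'' → A) :=
  Matrix.mulVecLin ((LinearMap.toMatrix' f).map (algebraMap k A))

variable {A : Type u} [CommRing A] [Algebra k A]

omit [Fintype E'] [DecidableEq E'] in
theorem extendScalars_algebraMap (f : (E → k) →ₗ[k] (E'' → k)) (v : E → k) :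
    extendScalars A f (fun e => algebraMap k A (v e)) = fun e => algebraMap k A (f v e) := by
  funext e
  conv_rhs => rw [← LinearMap.toMatrix'_mulVec f v]
  simp [extendScalars, Matrix.mulVec, dotProduct, map_sum]

/-- The standard basis of `A^E` comes from `k^E`. Linear identities proved over `k` pass to every
`A` in this way, with no exactness argument. -/
theorem linearMap_ext_of_algebraMap {M : Type*} [AddCommGroup M] [Module A M]
    {f g : (E → A) →ₗ[A] M}
    (h : ∀ v : E → k, f (fun e => algebraMap k A (v e)) = g (fun e => algebraMap k A (v e))) :
    f = g := by
  refine LinearMap.pi_ext' fun i => LinearMap.ext_ring ?_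
  have := h (Pi.single i 1)
  have h2 : (fun e => algebraMap k A ((Pi.single i 1 : E → k) e)) = Pi.single i 1 := by
    funext e
    by_cases he : e = i
    · subst he; simp
    · simp [he]
  rw [h2] at this
  simpa using this

theorem extendScalars_comp (f : (E → k) →ₗ[k] (E' → k)) (g : (E' → k) →ₗ[k] (E'' → k)) :
    extendScalars A (g ∘ₗ f) = extendScalars A g ∘ₗ extendScalars A f := by
  refine linearMap_ext_of_algebraMap (k := k) fun v => ?_
  simp [extendScalars_algebraMap]

theorem extendScalars_naturality {A' : Type u} [CommRing A'] [Algebra k A'] (φ : A →ₐ[k] A')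
    (f : (E → k) →ₗ[k] (E'' → k)) (v : E → A) :
    extendScalars A' f (fun e => φ (v e)) = fun e => φ (extendScalars A f v e) := by
  funext e
  simp [extendScalars, Matrix.mulVec, dotProduct, map_sum]

/-- Extend a section of `V → range f` to all of `W`. The identity `f g f = f` survives base change
and makes `id - g f` a projection onto the kernel. -/
theorem exists_generalizedInverse {V W : Type*} [AddCommGroup V] [Module k V] [AddCommGroup W]
    [Module k W] (f : V →ₗ[k] W) : ∃ g : W →ₗ[k] V, ∀ x, f (g (f x)) = f x := by
  obtain ⟨s, hs⟩ := f.rangeRestrict.exists_rightInverse_of_surjective f.range_rangeRestrict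
  obtain ⟨g, hg⟩ := LinearMap.exists_extend s
  refine ⟨g, fun x => ?_⟩
  have h1 : g (f x) = s (f.rangeRestrict x) := congr($hg (f.rangeRestrict x))
  have h2 := congr(($hs (f.rangeRestrict x) : W))
  rw [h1]
  exact h2

open Classical in
/-- The solutions of a system of linear equations with coefficients in `k` form an affine space,
unless the system is inconsistent. -/
theorem hasClass_linearSystem
    (Θ : ∀ (A : Type u) [CommRing A] [Algebra k A], (E → A) →ₗ[A] (E' → A))
    (hΘ : ∀ (A : Type u) [CommRing A] [Algebra k A] (v : E → k),
      Θ A (fun e => algebraMap k A (v e)) = fun e => algebraMap k A (Θ k v e)) (b : E' → k) :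
    HasClass (k := k) (fun A _ _ => {v | Θ A v = fun e => algebraMap k A (b e)})
      (if b ∈ LinearMap.range (Θ k) then
        (affineLine k).cls₀ ^ Module.finrank k (LinearMap.ker (Θ k)) else 0) := by
  have hΘ' : ∀ (A : Type u) [CommRing A] [Algebra k A], Θ A = extendScalars A (Θ k) := by
    intro A _ _
    refine linearMap_ext_of_algebraMap (k := k) fun v => ?_
    rw [hΘ, extendScalars_algebraMap]
  split_ifs with hb
  · obtain ⟨w₀, rfl⟩ := hb
    set D := Module.finrank k (LinearMap.ker (Θ k))
    let β : Module.Basis (Fin D) k (LinearMap.ker (Θ k)) := Module.finBasis k _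
    let i : (Fin D → k) →ₗ[k] (E → k) :=
      (LinearMap.ker (Θ k)).subtype ∘ₗ β.equivFun.symm.toLinearMap
    obtain ⟨g, hg⟩ := exists_generalizedInverse (Θ k)
    let π : (E → k) →ₗ[k] LinearMap.ker (Θ k) :=
      LinearMap.codRestrict _ (LinearMap.id - g ∘ₗ Θ k) fun x => by simp [hg]
    let r : (E → k) →ₗ[k] (Fin D → k) := β.equivFun.toLinearMap ∘ₗ π
    have hΘi : Θ k ∘ₗ i = 0 := by
      ext x : 2
      simp only [LinearMap.comp_apply, i]
      exact (β.equivFun.symm _).2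
    have hri : r ∘ₗ i = LinearMap.id := by
      refine LinearMap.ext fun x => ?_
      have : π (i x) = β.equivFun.symm x := by
        apply Subtype.ext
        have h0 : Θ k (i x) = 0 := congr($hΘi x)
        simp only [π, LinearMap.codRestrict_apply, LinearMap.sub_apply, LinearMap.comp_apply, h0,
          map_zero, sub_zero, LinearMap.id_apply]
        rfl
      simp only [r, LinearMap.comp_apply, this, LinearMap.id_apply]
      exact β.equivFun.apply_symm_apply x
    have hir : ∀ x, i (r x) + g (Θ k x) = x := by
      intro x
      simp [i, r, π]
    refine (hasClass_univ D).map
      (fun A _ _ v e => algebraMap k A (w₀ e) + extendScalars A i v e) ?_ ?_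
    · intro A A' _ _ _ _ φ v _
      funext e
      simp [extendScalars_naturality]
    · intro A _ _
      have e1 : ∀ v, Θ A (extendScalars A i v) = 0 := by
        intro v
        have : Θ A ∘ₗ extendScalars A i = 0 := by
          rw [hΘ', ← extendScalars_comp, hΘi]
          refine linearMap_ext_of_algebraMap (k := k) fun v => ?_
          rw [extendScalars_algebraMap]
          simp; rfl
        exact congr($this v)
      have e2 : ∀ v, extendScalars A r (extendScalars A i v) = v := by
        intro v
        have : extendScalars A r ∘ₗ extendScalars A i = LinearMap.id := by
          rw [← extendScalars_comp, hri]
          refine linearMap_ext_of_algebraMap (k := k) fun v => ?_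
          rw [extendScalars_algebraMap]
          rfl
        exact congr($this v)
      have e3 : ∀ v, extendScalars A i (extendScalars A r v) + extendScalars A g (Θ A v) = v := by
        intro v
        have : extendScalars A i ∘ₗ extendScalars A r + extendScalars A g ∘ₗ Θ A =
            LinearMap.id := by
          rw [hΘ']
          refine linearMap_ext_of_algebraMap (k := k) fun v => ?_
          simp only [LinearMap.add_apply, LinearMap.comp_apply, extendScalars_algebraMap,
            LinearMap.id_apply]
          funext e
          conv_rhs => rw [← hir v]
          simp
        exact congr($this v)
      have e4 : ∀ v, (fun e => algebraMap k A (w₀ e) + extendScalars A i v e) =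
          (fun e => algebraMap k A (w₀ e)) + extendScalars A i v := fun v => rfl
      refine ⟨?_, ?_, ?_⟩
      · intro v _
        change Θ A ((fun e => algebraMap k A (w₀ e)) + extendScalars A i v) = _
        rw [map_add, e1, hΘ, add_zero]
      · intro v _ w _ hvw
        simp only [e4] at hvw
        rw [← e2 v, ← e2 w]
        exact congrArg _ (add_left_cancel hvw)
      · intro v hv
        refine ⟨extendScalars A r (v - fun e => algebraMap k A (w₀ e)), trivial, ?_⟩
        have h0 : Θ A (v - fun e => algebraMap k A (w₀ e)) = 0 := by
          rw [map_sub, hΘ]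
          exact sub_eq_zero.mpr hv
        have := e3 (v - fun e => algebraMap k A (w₀ e))
        rw [h0, map_zero, add_zero] at this
        simp only [e4]
        rw [this]
        simp
  · refine HasClass.of_empty fun A _ _ => ⟨?_, fun _ => ⟨0, Subsingleton.elim _ _⟩⟩
    rintro ⟨v, hv⟩
    -- Certificate of inconsistency: a functional that kills the range but not `b`. A solution over
    -- `A` would make the unit `f(b)` zero in `A`.
    obtain ⟨f, hf1, hf2⟩ := Submodule.exists_le_ker_of_notMem hb
    let f' : (E' → k) →ₗ[k] (Unit → k) := LinearMap.pi fun _ => f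
    have h1 : f' ∘ₗ Θ k = 0 := by
      refine LinearMap.ext fun x => ?_
      funext _
      exact hf2 ⟨x, rfl⟩
    have h2 : extendScalars A f' (Θ A v) = 0 := by
      have : extendScalars A f' ∘ₗ Θ A = 0 := by
        rw [hΘ', ← extendScalars_comp, h1]
        refine linearMap_ext_of_algebraMap (k := k) fun v => ?_
        rw [extendScalars_algebraMap]
        simp; rfl
      exact congr($this v)
    rw [hv, extendScalars_algebraMap] at h2
    have h3 : algebraMap k A (f b) = 0 := congrFun h2 ()
    have h4 : IsUnit (algebraMap k A (f b)) := (Ne.isUnit hf1).map _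
    rw [h3, isUnit_zero_iff] at h4
    exact subsingleton_of_zero_eq_one h4

/-- Inclusion-exclusion for the complement of a hyperplane arrangement. -/
theorem hasClass_arrangement {E : Type} {ι : Type} [DecidableEq ι] {X : PointSet k E}
    (e : ι → E) {c : Finset ι → K₀Var k}
    (h : ∀ I, HasClass (k := k) (fun A _ _ => {v | v ∈ X A ∧ ∀ i ∈ I, v (e i) = 0}) (c I))
    (T I : Finset ι) :
    HasClass (k := k)
      (fun A _ _ => {v | (v ∈ X A ∧ ∀ i ∈ I, v (e i) = 0) ∧ ∀ i ∈ T, IsUnit (v (e i))})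
      (∑ I' ∈ T.powerset, (-1) ^ I'.card * c (I ∪ I')) := by
  induction T using Finset.induction_on generalizing I with
  | empty =>
    have h0 : ∑ I' ∈ (∅ : Finset ι).powerset, (-1) ^ I'.card * c (I ∪ I') = c I := by simp
    rw [h0]
    exact (h I).congr fun A _ _ => by simp
  | insert a T ha ih =>
    -- Deletion and restriction: from the complement of the other hyperplanes, remove its part on
    -- the hyperplane of `a`, which is the same problem for `I ∪ {a}`.
    have h1 := ih I
    have h2 := ih (insert a I)
    have h3 := HasClass.isUnit (e₀ := e a) h1 (h2.congr fun A _ _ => by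
      ext v
      simp only [Finset.mem_insert, forall_eq_or_imp, Set.mem_ofPred_eq]
      tauto)
    rw [Finset.sum_powerset_insert ha]
    convert h3.congr fun A _ _ => ?_ using 1
    · rw [sub_eq_add_neg, ← Finset.sum_neg_distrib]
      congr 1
      refine Finset.sum_congr rfl fun t ht => ?_
      have : a ∉ t := fun hat => ha (Finset.mem_powerset.mp ht hat)
      rw [Finset.card_insert_of_notMem this, pow_succ, Finset.union_insert, Finset.insert_union]
      ring
    · ext v
      simp only [Finset.mem_insert, forall_eq_or_imp, Set.mem_ofPred_eq]
      tauto

end LinearSystems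
end CurveSing

namespace CurveSing

/-! ### Projections compatible with a filtration -/

section Filtration

variable {k V : Type*} [Field k] [AddCommGroup V] [Module k V]

/-- Downward induction along the filtration, with `r` counting the steps below `N` and `q = 0` at
the start, where `F N = ⊥`. -/
theorem exists_filtered_retraction (W : Submodule k V) (F : ℕ → Submodule k V) (hF : Antitone F)
    (N : ℕ) (hN : F N = ⊥) (r : ℕ) (hr : r ≤ N) :
    ∃ q : V →ₗ[k] V, (∀ x, q x ∈ W) ∧ (∀ x ∈ W ⊓ F (N - r), q x = x) ∧
      ∀ i, N - r ≤ i → ∀ x ∈ F i, q x ∈ F i := by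
  induction r with
  | zero =>
    refine ⟨0, fun x => by simp, fun x hx => ?_, fun i _ x _ => by simp⟩
    rw [Nat.sub_zero, hN] at hx
    simpa using hx.2.symm
  | succ r ih =>
    obtain ⟨q', h1, h2, h3⟩ := ih (by omega)
    set j := N - (r + 1) with hj
    have hj1 : N - r = j + 1 := by omega
    rw [hj1] at h2 h3
    -- Glue the previous map on `F (j + 1)` to the identity on `W ⊓ F j`; they agree on the overlap.
    -- Extending with values in `W ⊓ F j` keeps the image inside both `W` and the new filtration
    -- step.
    let f₁ : V →ₗ.[k] ↥(W ⊓ F j) := ⟨F (j + 1),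
      LinearMap.codRestrict _ (q' ∘ₗ (F (j + 1)).subtype) fun x =>
        ⟨h1 _, hF (Nat.le_succ j) (h3 _ le_rfl _ x.2)⟩⟩
    let f₂ : V →ₗ.[k] ↥(W ⊓ F j) := ⟨W ⊓ F j, LinearMap.id⟩
    have hcomp : ∀ (x : f₁.domain) (y : f₂.domain), (x : V) = y → f₁ x = f₂ y := by
      intro x y hxy
      apply Subtype.ext
      change q' (x : V) = (y : V)
      rw [h2 _ ⟨?_, x.2⟩, hxy]
      rw [hxy]
      exact y.2.1
    obtain ⟨g, hg⟩ := LinearMap.exists_extend (f₁.sup f₂ hcomp).toFun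
    have hg1 : ∀ x ∈ F (j + 1), (g x : V) = q' x := by
      intro x hx
      have hle := LinearPMap.left_le_sup f₁ f₂ hcomp
      have hx' : x ∈ (f₁.sup f₂ hcomp).domain := hle.1 hx
      have e1 : g x = (f₁.sup f₂ hcomp) ⟨x, hx'⟩ := congr($hg ⟨x, hx'⟩)
      have e2 : f₁ ⟨x, hx⟩ = (f₁.sup f₂ hcomp) ⟨x, hx'⟩ := hle.2 rfl
      rw [e1, ← e2]
      rfl
    have hg2 : ∀ x ∈ W ⊓ F j, (g x : V) = x := by
      intro x hx
      have hle := LinearPMap.right_le_sup f₁ f₂ hcomp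
      have hx' : x ∈ (f₁.sup f₂ hcomp).domain := hle.1 hx
      have e1 : g x = (f₁.sup f₂ hcomp) ⟨x, hx'⟩ := congr($hg ⟨x, hx'⟩)
      have e2 : f₂ ⟨x, hx⟩ = (f₁.sup f₂ hcomp) ⟨x, hx'⟩ := hle.2 rfl
      rw [e1, ← e2]
      rfl
    refine ⟨(W ⊓ F j).subtype ∘ₗ g, fun x => (g x).2.1, hg2, fun i hi x hx => ?_⟩
    rcases hi.eq_or_lt with rfl | hi
    · exact (g x).2.2
    · have : (g x : V) = q' x := hg1 x (hF hi hx)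
      simp only [LinearMap.comp_apply, Submodule.subtype_apply, this]
      exact h3 i hi x hx

/-- Every subspace is the kernel of a projection that respects a given finite filtration. -/
theorem exists_filtered_projection (W : Submodule k V) (F : ℕ → Submodule k V) (hF : Antitone F)
    (N : ℕ) (hN : F N = ⊥) (h0 : F 0 = ⊤) :
    ∃ p : V →ₗ[k] V, (∀ x, p x = 0 ↔ x ∈ W) ∧ (∀ x, p (p x) = p x) ∧
      ∀ i, ∀ x ∈ F i, p x ∈ F i := by
  obtain ⟨q, h1, h2, h3⟩ := exists_filtered_retraction W F hF N hN N le_rfl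
  rw [Nat.sub_self, h0, inf_top_eq] at h2
  refine ⟨LinearMap.id - q, fun x => ⟨fun h => ?_, fun h => ?_⟩, fun x => ?_, fun i x hx => ?_⟩
  · rw [LinearMap.sub_apply, sub_eq_zero, LinearMap.id_apply] at h
    rw [h]; exact h1 x
  · simp [h2 x h]
  · simp [h2 _ (h1 x)]
  · exact sub_mem hx (h3 i (by omega) x hx)

end Filtration

/-! ### The `t`-adic filtration and jets -/

section Jets

variable {d : ℕ}

/-- The ideal `(t₁^j, …, t_d^j)`. -/
noncomputable def tIdeal (d : ℕ) (A : Type u) [CommRing A] (j : ℕ) : Ideal (Fin d → A⟦X⟧) :=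
  Ideal.span {fun _ => X ^ j}

variable {A : Type u} [CommRing A]

theorem mem_tIdeal {j : ℕ} {z : Fin d → A⟦X⟧} : z ∈ tIdeal d A j ↔ ∀ i, X ^ j ∣ z i := by
  rw [tIdeal, Ideal.mem_span_singleton, pi_dvd_iff]

theorem mem_tIdeal_iff_coeff {j : ℕ} {z : Fin d → A⟦X⟧} :
    z ∈ tIdeal d A j ↔ ∀ i, ∀ m < j, coeff m (z i) = 0 := by
  simp only [mem_tIdeal, X_pow_dvd_iff]

theorem mul_mem_tIdeal {a b : ℕ} {z w : Fin d → A⟦X⟧} (hz : z ∈ tIdeal d A a)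
    (hw : w ∈ tIdeal d A b) : z * w ∈ tIdeal d A (a + b) := by
  rw [mem_tIdeal] at *
  intro i
  rw [pow_add]
  exact mul_dvd_mul (hz i) (hw i)

theorem tIdeal_antitone : Antitone (tIdeal d A) := fun a b h z hz => by
  rw [mem_tIdeal] at *
  exact fun i => (pow_dvd_pow _ h).trans (hz i)

theorem mem_tIdeal_one {z : Fin d → A⟦X⟧} : z ∈ tIdeal d A 1 ↔ ∀ i, constantCoeff (z i) = 0 := by
  simp [mem_tIdeal, X_dvd_iff]

theorem mapCoeff_mem_tIdeal {A' : Type u} [CommRing A'] (f : A →+* A') {j : ℕ}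
    {z : Fin d → A⟦X⟧} (hz : z ∈ tIdeal d A j) : mapCoeff d f z ∈ tIdeal d A' j := by
  rw [mem_tIdeal_iff_coeff] at *
  intro i m hm
  rw [mapCoeff_apply, coeff_map, hz i m hm, map_zero]

/-- The coefficients of order less than `N` of a tuple of power series. -/
noncomputable def jet (A : Type u) [CommRing A] (d N : ℕ) :
    (Fin d → A⟦X⟧) →ₗ[A] (Fin d × Fin N → A) :=
  LinearMap.pi fun e => coeff e.2 ∘ₗ LinearMap.proj e.1

/-- The tuple of polynomials of degree less than `N` with given coefficients. -/
noncomputable def ofJet (A : Type u) [CommRing A] (d N : ℕ) :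
    (Fin d × Fin N → A) →ₗ[A] (Fin d → A⟦X⟧) where
  toFun v i := PowerSeries.mk fun m => if h : m < N then v (i, ⟨m, h⟩) else 0
  map_add' v w := by
    funext i; ext m
    by_cases h : m < N <;> simp [h]
  map_smul' r v := by
    funext i; ext m
    by_cases h : m < N <;> simp [h]

variable {N : ℕ}

theorem jet_apply (z : Fin d → A⟦X⟧) (i : Fin d) (m : Fin N) :
    jet A d N z (i, m) = coeff m (z i) := rfl

theorem coeff_ofJet (v : Fin d × Fin N → A) (i : Fin d) (m : ℕ) :
    coeff m (ofJet A d N v i) = if h : m < N then v (i, ⟨m, h⟩) else 0 := by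
  simp [ofJet]

theorem jet_ofJet (v : Fin d × Fin N → A) : jet A d N (ofJet A d N v) = v := by
  funext ⟨i, m⟩
  rw [jet_apply, coeff_ofJet, dif_pos m.2]

theorem jet_eq_zero_iff {z : Fin d → A⟦X⟧} : jet A d N z = 0 ↔ z ∈ tIdeal d A N := by
  rw [mem_tIdeal_iff_coeff]
  constructor
  · intro h i m hm
    exact congrFun h (i, ⟨m, hm⟩)
  · intro h
    funext ⟨i, m⟩
    exact h i m m.2

theorem jet_eq_iff {z w : Fin d → A⟦X⟧} : jet A d N z = jet A d N w ↔ z - w ∈ tIdeal d A N := by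
  rw [← jet_eq_zero_iff, map_sub, sub_eq_zero]

theorem ofJet_jet_sub_mem (z : Fin d → A⟦X⟧) : ofJet A d N (jet A d N z) - z ∈ tIdeal d A N := by
  rw [← jet_eq_iff, jet_ofJet]

theorem jet_mapCoeff {A' : Type u} [CommRing A'] (f : A →+* A') (z : Fin d → A⟦X⟧) :
    jet A' d N (mapCoeff d f z) = fun e => f (jet A d N z e) := by
  funext ⟨i, m⟩
  simp [jet_apply, mapCoeff_apply]

theorem mapCoeff_ofJet {A' : Type u} [CommRing A'] (f : A →+* A') (v : Fin d × Fin N → A) :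
    mapCoeff d f (ofJet A d N v) = ofJet A' d N fun e => f (v e) := by
  funext i
  ext m
  rw [mapCoeff_apply, coeff_map, coeff_ofJet, coeff_ofJet]
  split_ifs <;> simp

theorem ofJet_mem_tIdeal {j : ℕ} {v : Fin d × Fin N → A} :
    ofJet A d N v ∈ tIdeal d A j ↔ ∀ i (m : Fin N), (m : ℕ) < j → v (i, m) = 0 := by
  rw [mem_tIdeal_iff_coeff]
  simp only [coeff_ofJet]
  constructor
  · intro h i m hm
    simpa using h i m hm
  · intro h i m hm
    split_ifs with h'
    · exact h i ⟨m, h'⟩ hm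
    · rfl

end Jets

/-! ### Existence of a conductor exponent -/

section Conductor

variable {k : Type u} [Field k] {d : ℕ}

/-- For each `i`, the polynomials in `t_i` lying in `𝒪` form an infinite-dimensional space `K`,
which acts by multiplication on the finite-dimensional `𝒪̃/𝒪`. Some nonzero `f ∈ K` therefore acts
as zero, that is, `f 𝒪̃ ⊆ 𝒪`, and `f` is a power of `t_i` times a unit. -/
theorem exists_conductor (O : Subalgebra k (Fin d → k⟦X⟧))
    [Module.Finite k ((Fin d → k⟦X⟧) ⧸ Subalgebra.toSubmodule O)] :
    ∃ N, 0 < N ∧ ∀ z ∈ tIdeal d k N, z ∈ O := by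
  have key : ∀ i : Fin d, ∃ N : ℕ, ∀ y : k⟦X⟧, Pi.single i (X ^ N * y) ∈ O := by
    intro i
    let M := Subalgebra.toSubmodule O
    let ι : Polynomial k →ₗ[k] (Fin d → k⟦X⟧) :=
      LinearMap.single k (fun _ => k⟦X⟧) i ∘ₗ (Polynomial.coeToPowerSeries.algHom k).toLinearMap
    let θ : Polynomial k →ₗ[k] ((Fin d → k⟦X⟧) ⧸ M) := M.mkQ ∘ₗ ι
    let K := LinearMap.ker θ
    have hK : ∀ f : K, ι f ∈ O := fun f => by
      have : θ f = 0 := f.2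
      exact (Submodule.Quotient.mk_eq_zero M).mp this
    let Ψ : K →ₗ[k] (((Fin d → k⟦X⟧) ⧸ M) →ₗ[k] ((Fin d → k⟦X⟧) ⧸ M)) :=
      { toFun := fun f => M.mapQ M (LinearMap.mulLeft k (ι f)) fun x hx => mul_mem (hK f) hx
        map_add' := fun f g => by
          apply LinearMap.ext
          intro x
          obtain ⟨x, rfl⟩ := M.mkQ_surjective x
          change M.mkQ (ι (f + g : K) * x) = M.mkQ (ι f * x) + M.mkQ (ι g * x)
          rw [Submodule.coe_add, map_add, add_mul, map_add]
        map_smul' := fun r f => by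
          apply LinearMap.ext
          intro x
          obtain ⟨x, rfl⟩ := M.mkQ_surjective x
          change M.mkQ (ι (r • f : K) * x) = r • M.mkQ (ι f * x)
          rw [Submodule.coe_smul, map_smul, smul_mul_assoc, map_smul] }
    have hinj : ¬ Function.Injective Ψ := by
      intro h
      have h1 : Module.Finite k K := Module.Finite.of_injective Ψ h
      have h2 : Module.Finite k (Polynomial k ⧸ K) :=
        Module.Finite.of_injective (K.liftQ θ le_rfl)
          (LinearMap.ker_eq_bot.mp (Submodule.ker_liftQ_eq_bot' _ _ rfl))
      have h3 : Module.Finite k (Polynomial k) := Module.Finite.of_submodule_quotient K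
      exact Polynomial.not_finite h3
    obtain ⟨f, hf0, hf⟩ : ∃ f : K, Ψ f = 0 ∧ f ≠ 0 := by
      by_contra! h
      exact hinj ((injective_iff_map_eq_zero Ψ).mpr h)
    have hf' : ((f : Polynomial k) : k⟦X⟧) ≠ 0 := by
      intro h
      apply hf
      apply Subtype.ext
      exact Polynomial.coe_injective k (by simpa using h)
    have hmem : ∀ y : k⟦X⟧, Pi.single i (((f : Polynomial k) : k⟦X⟧) * y) ∈ O := by
      intro y
      have h1 : Ψ f (M.mkQ (Pi.single i y)) = 0 := by rw [hf0]; rfl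
      have h2 : ι f * Pi.single i y ∈ O := (Submodule.Quotient.mk_eq_zero M).mp h1
      have h3 : ι f * Pi.single i y = Pi.single i (((f : Polynomial k) : k⟦X⟧) * y) := by
        simp [ι, ← Pi.single_mul]
      rwa [h3] at h2
    refine ⟨(((f : Polynomial k) : k⟦X⟧)).order.toNat, fun y => ?_⟩
    obtain ⟨w, hw⟩ : ((f : Polynomial k) : k⟦X⟧) ∣
        X ^ (((f : Polynomial k) : k⟦X⟧)).order.toNat := by
      rw [← (isUnit_divided_by_X_pow_order hf').dvd_mul_right, X_pow_order_mul_divXPowOrder]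
    rw [hw, mul_assoc]
    exact hmem _
  choose n hn using key
  -- The sum dominates every `n i`; the `+ 1` makes `N` positive, so that jets of order `< N` always
  -- contain the constant term.
  refine ⟨∑ i, n i + 1, Nat.succ_pos _, fun z hz => ?_⟩
  rw [mem_tIdeal] at hz
  have : z = ∑ i, Pi.single i (z i) := (Finset.univ_sum_single z).symm
  rw [this]
  refine sum_mem fun i _ => ?_
  obtain ⟨y, hy⟩ := (pow_dvd_pow (X : k⟦X⟧) (show n i ≤ ∑ i, n i + 1 from
    (Finset.single_le_sum (fun _ _ => Nat.zero_le _) (Finset.mem_univ i)).trans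
      (Nat.le_succ _))).trans (hz i)
  rw [hy]
  exact hn i y

end Conductor
end CurveSing

namespace CurveSing

/-! ### Splitting off `𝒪_A` over every algebra, and factorization of units -/

variable {k : Type u} [Field k] {d N : ℕ}

/-- A projection of the jet space with kernel the jets of `O`, which respects the `t`-adic
filtration, for `N` such that `t^N 𝒪̃ ⊆ 𝒪`. -/
structure JetSplitting (O : Subalgebra k (Fin d → k⟦X⟧)) (N : ℕ) where
  pos : 0 < N
  conductor : ∀ z ∈ tIdeal d k N, z ∈ O
  proj : (Fin d × Fin N → k) →ₗ[k] (Fin d × Fin N → k)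
  proj_eq_zero : ∀ v, proj v = 0 ↔ ofJet k d N v ∈ O
  proj_proj : ∀ v, proj (proj v) = proj v
  proj_filtered : ∀ j v, ofJet k d N v ∈ tIdeal d k j → ofJet k d N (proj v) ∈ tIdeal d k j

theorem exists_jetSplitting (O : Subalgebra k (Fin d → k⟦X⟧))
    [Module.Finite k ((Fin d → k⟦X⟧) ⧸ Subalgebra.toSubmodule O)] :
    ∃ N, Nonempty (JetSplitting O N) := by
  obtain ⟨N, h0, hN⟩ := exists_conductor O
  let F : ℕ → Submodule k (Fin d × Fin N → k) := fun j =>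
    ((tIdeal d k j).restrictScalars k).comap (ofJet k d N)
  have hF : ∀ j v, v ∈ F j ↔ ofJet k d N v ∈ tIdeal d k j := fun j v => Iff.rfl
  obtain ⟨p, h1, h2, h3⟩ := exists_filtered_projection
    ((Subalgebra.toSubmodule O).comap (ofJet k d N)) F
    (fun a b h v hv => tIdeal_antitone h hv) N
    (by
      rw [eq_bot_iff]
      intro v hv
      rw [hF, ← jet_eq_zero_iff, jet_ofJet] at hv
      exact hv)
    (by
      rw [eq_top_iff]
      intro v _
      rw [hF, mem_tIdeal]
      simp)
  exact ⟨N, ⟨⟨h0, hN, p, h1, h2, h3⟩⟩⟩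

section Basics

variable (A : Type u) [CommRing A] [Algebra k A]

theorem extendScalars_eq_sum {E E'' : Type} [Fintype E] [DecidableEq E]
    (f : (E → k) →ₗ[k] (E'' → k)) (v : E → A) :
    extendScalars A f v = ∑ e, v e • fun e' => algebraMap k A (f (Pi.single e 1) e') := by
  funext e'
  simp [extendScalars, Matrix.mulVec, dotProduct, LinearMap.toMatrix'_apply, mul_comm]

theorem extendScalars_self {E E'' : Type} [Fintype E] [DecidableEq E]
    (f : (E → k) →ₗ[k] (E'' → k)) (v : E → k) : extendScalars k f v = f v :=
  extendScalars_algebraMap (A := k) f v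

theorem extendScalars_sub {E E'' : Type} [Fintype E] [DecidableEq E]
    (f g : (E → k) →ₗ[k] (E'' → k)) :
    extendScalars A (f - g) = extendScalars A f - extendScalars A g := by
  refine linearMap_ext_of_algebraMap (k := k) fun v => ?_
  rw [LinearMap.sub_apply, extendScalars_algebraMap, extendScalars_algebraMap,
    extendScalars_algebraMap]
  funext e
  simp

theorem extendScalars_id {E : Type} [Fintype E] [DecidableEq E] :
    extendScalars A (LinearMap.id : (E → k) →ₗ[k] (E → k)) = LinearMap.id := by
  refine linearMap_ext_of_algebraMap (k := k) fun v => ?_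
  rw [extendScalars_algebraMap]
  rfl

variable (O : Subalgebra k (Fin d → k⟦X⟧))

theorem mapCoeff_mem_adjoin {w : Fin d → k⟦X⟧} (hw : w ∈ O) :
    mapCoeff d (algebraMap k A) w ∈ Algebra.adjoin A (mapCoeff d (algebraMap k A) '' O) :=
  Algebra.subset_adjoin ⟨w, hw, rfl⟩

theorem ofJet_extendScalars_mem_adjoin {M : ℕ} {E : Type} [Fintype E] [DecidableEq E]
    (f : (E → k) →ₗ[k] (Fin d × Fin M → k)) (v : E → A)
    (hf : ∀ e, v e = 0 ∨ ofJet k d M (f (Pi.single e 1)) ∈ O) :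
    ofJet A d M (extendScalars A f v) ∈
      Algebra.adjoin A (mapCoeff d (algebraMap k A) '' O) := by
  rw [extendScalars_eq_sum, map_sum]
  refine sum_mem fun e _ => ?_
  rw [map_smul, ← mapCoeff_ofJet]
  rcases hf e with h | h
  · rw [h, zero_smul]; exact zero_mem _
  · exact Subalgebra.smul_mem _ (mapCoeff_mem_adjoin A O h) _

theorem adjoin_le_family : Algebra.adjoin A (mapCoeff d (algebraMap k A) '' O) ≤ family O A :=
  fun y hy _ => ⟨y, hy, fun i => by simp⟩

variable {O A}

/-- With `c_i ≠ c_j` the constant terms of `w`, both `w - c_i` and `w - c_j` would be nonunits, yet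
their difference is a nonzero constant. This is where locality of `𝒪` enters. -/
theorem constantCoeff_eq_of_mem [IsLocalRing O] {w : Fin d → k⟦X⟧} (hw : w ∈ O) (i j : Fin d) :
    constantCoeff (w i) = constantCoeff (w j) := by
  by_contra hne
  have nonunit : ∀ l : Fin d,
      (⟨w, hw⟩ - algebraMap k O (constantCoeff (w l)) : O) ∈ nonunits O := by
    intro l hu
    have h1 := hu.map ((Pi.evalRingHom (fun _ : Fin d => k⟦X⟧) l).comp O.val.toRingHom)
    have h2 := h1.map (constantCoeff (R := k))
    simp [Pi.algebraMap_apply] at h2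
  have h : (⟨w, hw⟩ - algebraMap k O (constantCoeff (w i)) : O) -
      (⟨w, hw⟩ - algebraMap k O (constantCoeff (w j)) : O) ∈ IsLocalRing.maximalIdeal O :=
    sub_mem ((IsLocalRing.mem_maximalIdeal _).mpr (nonunit i))
      ((IsLocalRing.mem_maximalIdeal _).mpr (nonunit j))
  refine (IsLocalRing.mem_maximalIdeal _).mp h ?_
  have : (⟨w, hw⟩ - algebraMap k O (constantCoeff (w i)) : O) -
      (⟨w, hw⟩ - algebraMap k O (constantCoeff (w j)) : O) =
      algebraMap k O (constantCoeff (w j) - constantCoeff (w i)) := by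
    rw [map_sub]; exact sub_sub_sub_cancel_left _ _ _
  rw [this]
  exact (sub_ne_zero.mpr (Ne.symm hne)).isUnit.map _

theorem constantCoeff_eq_of_mem_family [IsLocalRing O] {z : Fin d → A⟦X⟧} (hz : z ∈ family O A)
    (i j : Fin d) : constantCoeff (z i) = constantCoeff (z j) := by
  obtain ⟨y, hy, h⟩ := hz 1
  have h' : ∀ i, constantCoeff (z i) = constantCoeff (y i) := by
    intro i
    have := h i
    rwa [pow_one, X_dvd_iff, map_sub, sub_eq_zero] at this
  rw [h', h']
  clear h h'
  induction hy using Algebra.adjoin_induction with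
  | mem x hx =>
    obtain ⟨w, hw, rfl⟩ := hx
    have := constantCoeff_eq_of_mem hw i j
    simp only [← coeff_zero_eq_constantCoeff_apply] at this
    simp only [← coeff_zero_eq_constantCoeff_apply, mapCoeff_apply, coeff_map]
    rw [this]
  | algebraMap r => simp [Pi.algebraMap_apply]
  | add x y _ _ hx hy => simp [hx, hy]
  | mul x y _ _ hx hy => simp [hx, hy]

theorem isUnit_tuple_iff {z : Fin d → A⟦X⟧} : IsUnit z ↔ ∀ i, IsUnit (constantCoeff (z i)) := by
  simp [Pi.isUnit_iff, PowerSeries.isUnit_iff_constantCoeff]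

end Basics

namespace JetSplitting

variable {O : Subalgebra k (Fin d → k⟦X⟧)} (S : JetSplitting O N)
variable {A : Type u} [CommRing A] [Algebra k A]

-- Up to any order, such a `z` is an `A`-combination of monomials of order at least `N`, which lie
-- in `𝒪`.
include S in
theorem tIdeal_le_family {z : Fin d → A⟦X⟧} (hz : z ∈ tIdeal d A N) : z ∈ family O A := by
  intro M
  refine ⟨ofJet A d M (jet A d M z), ?_, mem_tIdeal.mp ?_⟩
  · have := ofJet_extendScalars_mem_adjoin A O (M := M) LinearMap.id (jet A d M z) ?_
    · rwa [extendScalars_id] at this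
    rintro ⟨i, m⟩
    by_cases hm : (m : ℕ) < N
    · exact Or.inl (mem_tIdeal_iff_coeff.mp hz i m hm)
    · refine Or.inr (S.conductor _ (ofJet_mem_tIdeal.mpr fun i' m' hm' => ?_))
      have : (i', m') ≠ (i, m) := by
        rintro ⟨⟩
        exact hm hm'
      simp [this]
  · have := neg_mem (ofJet_jet_sub_mem (N := M) z)
    rwa [neg_sub] at this

/-- The projection `S.proj` over `A`, as an endomorphism of the tuples of power series. -/
noncomputable def compl (A : Type u) [CommRing A] [Algebra k A] :
    (Fin d → A⟦X⟧) →ₗ[A] (Fin d → A⟦X⟧) :=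
  ofJet A d N ∘ₗ extendScalars A S.proj ∘ₗ jet A d N

theorem compl_apply (z : Fin d → A⟦X⟧) :
    S.compl A z = ofJet A d N (extendScalars A S.proj (jet A d N z)) := rfl

theorem compl_ofJet (v : Fin d × Fin N → A) :
    S.compl A (ofJet A d N v) = ofJet A d N (extendScalars A S.proj v) := by
  rw [compl_apply, jet_ofJet]

/-- The `t`-adic closure is cut out by the equations `p = 0` on jets. They hold on the span of `𝒪`;
conversely `id - p` sends jets to combinations of jets of `𝒪`, and tails of order at least `N` are
harmless. -/
theorem mem_family_iff_compl (z : Fin d → A⟦X⟧) : z ∈ family O A ↔ S.compl A z = 0 := by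
  constructor
  · intro hz
    obtain ⟨y, hy, h⟩ := hz N
    have hjet : jet A d N z = jet A d N y := jet_eq_iff.mpr (mem_tIdeal.mpr h)
    rw [compl_apply, hjet, ← compl_apply]
    have hy' : y ∈ Subalgebra.toSubmodule
      (Algebra.adjoin A (mapCoeff d (algebraMap k A) '' O)) := hy
    -- The image of `𝒪` is already closed under products, so the `A`-algebra it generates is its
    -- `A`-span.
    have hcl : (Submonoid.closure (mapCoeff d (algebraMap k A) '' O) : Set (Fin d → A⟦X⟧)) =
        mapCoeff d (algebraMap k A) '' O := by
      have := Submonoid.closure_eq (O.toSubmonoid.map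
        (mapCoeff d (algebraMap k A) : (Fin d → k⟦X⟧) →* (Fin d → A⟦X⟧)))
      exact congr(($this : Set (Fin d → A⟦X⟧)))
    rw [Algebra.adjoin_eq_span, hcl] at hy'
    clear hy h hjet
    induction hy' using Submodule.span_induction with
    | mem x hx =>
      obtain ⟨w, hw, rfl⟩ := hx
      have h0 : S.proj (jet k d N w) = 0 := by
        rw [S.proj_eq_zero]
        have := O.add_mem (S.conductor _ (ofJet_jet_sub_mem w)) hw
        rwa [sub_add_cancel] at this
      rw [compl_apply, jet_mapCoeff, extendScalars_algebraMap, h0]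
      simp only [Pi.zero_apply, map_zero]
      exact map_zero (ofJet A d N)
    | zero => exact map_zero _
    | add x y _ _ hx hy => rw [map_add, hx, hy, add_zero]
    | smul a x _ hx => rw [map_smul, hx, smul_zero]
  · intro hz
    have h0 : extendScalars A S.proj (jet A d N z) = 0 := by
      have := congrArg (jet A d N) hz
      rwa [compl_apply, jet_ofJet, map_zero] at this
    have h1 := ofJet_extendScalars_mem_adjoin A O (LinearMap.id - S.proj) (jet A d N z)
      fun e => Or.inr (by rw [← S.proj_eq_zero]; simp [S.proj_proj])
    rw [extendScalars_sub, LinearMap.sub_apply, h0, sub_zero, extendScalars_id] at h1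
    have h2 := adjoin_le_family A O h1
    have h3 := S.tIdeal_le_family (ofJet_jet_sub_mem z)
    have := sub_mem h2 h3
    rwa [LinearMap.id_apply, sub_sub_cancel] at this

theorem mem_family_iff (z : Fin d → A⟦X⟧) :
    z ∈ family O A ↔ extendScalars A S.proj (jet A d N z) = 0 := by
  rw [S.mem_family_iff_compl, compl_apply]
  refine ⟨fun h => ?_, fun h => by rw [h, map_zero]⟩
  have := congrArg (jet A d N) h
  rwa [jet_ofJet, map_zero] at this

theorem compl_compl (z : Fin d → A⟦X⟧) : S.compl A (S.compl A z) = S.compl A z := by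
  rw [S.compl_apply z, compl_ofJet, ← LinearMap.comp_apply (extendScalars A S.proj),
    ← extendScalars_comp]
  have : S.proj ∘ₗ S.proj = S.proj := LinearMap.ext S.proj_proj
  rw [this]

/-- Monomials are defined over `k`, so the compatibility of `p` with the filtration over `k` extends
by linearity. -/
theorem compl_mem_tIdeal {j : ℕ} {z : Fin d → A⟦X⟧} (hz : z ∈ tIdeal d A j) :
    S.compl A z ∈ tIdeal d A j := by
  rw [compl_apply, extendScalars_eq_sum, map_sum]
  refine sum_mem fun ⟨i, m⟩ _ => ?_
  rw [map_smul]
  by_cases hm : (m : ℕ) < j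
  · rw [jet_apply, mem_tIdeal_iff_coeff.mp hz i m hm, zero_smul]
    exact zero_mem _
  · refine Submodule.smul_of_tower_mem _ _ ?_
    rw [← mapCoeff_ofJet]
    refine mapCoeff_mem_tIdeal _ (S.proj_filtered j _ (ofJet_mem_tIdeal.mpr fun i' m' hm' => ?_))
    have : (i', m') ≠ (i, m) := by
        rintro ⟨⟩
        exact hm hm'
    simp [this]

theorem sub_compl_mem_family (z : Fin d → A⟦X⟧) : z - S.compl A z ∈ family O A := by
  rw [S.mem_family_iff_compl, map_sub, compl_compl, sub_self]

theorem compl_eq_of_sub_mem {z w : Fin d → A⟦X⟧} (h : z - w ∈ tIdeal d A N) :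
    S.compl A z = S.compl A w := by
  rw [compl_apply, compl_apply, jet_eq_iff.mpr h]

include S in
/-- The inverse of an element of `𝒪_A` that is invertible in `𝒪̃_A` lies in `𝒪_A`. -/
theorem inverse_mem_family [IsLocalRing O] {z w : Fin d → A⟦X⟧} (hz : z ∈ family O A)
    (h : z * w = 1) : w ∈ family O A := by
  rcases isEmpty_or_nonempty (Fin d) with hd | ⟨⟨i₀⟩⟩
  · have : w = z := Subsingleton.elim _ _
    rwa [this]
  have hu : IsUnit z := IsUnit.of_mul_eq_one w h
  obtain ⟨a, ha⟩ := isUnit_tuple_iff.mp hu i₀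
  -- After scaling, `z = a(1 - m)` with `m ∈ 𝒪_A` free of constant terms. The geometric sum inverts
  -- `1 - m` up to a multiple of `m ^ N`, which the conductor absorbs.
  let m : Fin d → A⟦X⟧ := 1 - (↑a⁻¹ : A) • z
  have hm : m ∈ family O A := sub_mem (one_mem _) (Subalgebra.smul_mem _ hz _)
  have hm1 : m ∈ tIdeal d A 1 := by
    rw [mem_tIdeal_one]
    intro i
    have := constantCoeff_eq_of_mem_family hz i i₀
    simp [m, this, ← ha]
  have hmN : ∀ j, m ^ j ∈ tIdeal d A j := by
    intro j
    induction j with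
    | zero => rw [mem_tIdeal]; simp
    | succ j ih => rw [pow_succ]; exact mul_mem_tIdeal ih hm1
  have hs : ∑ j ∈ Finset.range N, m ^ j ∈ family O A := sum_mem fun j _ => pow_mem hm j
  have h1 : (1 - m) * ∑ j ∈ Finset.range N, m ^ j = 1 - m ^ N := mul_neg_geom_sum m N
  have h2 : w * (1 - m) = (↑a⁻¹ : A) • 1 := by
    simp only [m, sub_sub_cancel]
    rw [mul_smul_comm, mul_comm, h]
  have h3 : w = (↑a⁻¹ : A) • ∑ j ∈ Finset.range N, m ^ j + w * m ^ N := by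
    calc w = w * (1 - m) * ∑ j ∈ Finset.range N, m ^ j + w * m ^ N := by
            rw [mul_assoc, h1]; ring
      _ = _ := by rw [h2, smul_mul_assoc, one_mul]
  rw [h3]
  exact add_mem (Subalgebra.smul_mem _ hs _)
    (S.tIdeal_le_family (Ideal.mul_mem_left _ _ (hmN N)))

include S in
theorem mem_unitSubgroup_iff [IsLocalRing O] (μ : (Fin d → A⟦X⟧)ˣ) :
    μ ∈ unitSubgroup O A ↔ (μ : Fin d → A⟦X⟧) ∈ family O A := by
  constructor
  · rintro ⟨w, rfl⟩
    exact w.1.2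
  · intro h
    refine ⟨⟨⟨_, h⟩, ⟨_, S.inverse_mem_family h μ.mul_inv⟩, ?_, ?_⟩, ?_⟩
    · exact Subtype.ext μ.mul_inv
    · exact Subtype.ext μ.inv_mul
    · exact Units.ext rfl

include S in
theorem mk_eq_mk_iff [IsLocalRing O] (μ ν : (Fin d → A⟦X⟧)ˣ) :
    (QuotientGroup.mk μ : JPoints O A) = QuotientGroup.mk ν ↔
      ∃ h ∈ family O A, (μ : Fin d → A⟦X⟧) * h = ν := by
  rw [QuotientGroup.eq, S.mem_unitSubgroup_iff]
  constructor
  · intro h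
    exact ⟨_, h, by simp [← mul_assoc]⟩
  · rintro ⟨h, hh, he⟩
    have : ((μ⁻¹ * ν : (Fin d → A⟦X⟧)ˣ) : Fin d → A⟦X⟧) = h := by
      rw [Units.val_mul, ← he, ← mul_assoc, Units.inv_mul, one_mul]
    rwa [this]

/-- `u ↦ u + p(u) (u - p(u))` is surjective on the tuples without constant terms. -/
theorem exists_add_mul_compl {w : Fin d → A⟦X⟧} (hw : w ∈ tIdeal d A 1) :
    ∃ u ∈ tIdeal d A 1, u + S.compl A u * (u - S.compl A u) - w ∈ tIdeal d A N := by
  have key : ∀ j, ∃ u ∈ tIdeal d A 1,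
      u + S.compl A u * (u - S.compl A u) - w ∈ tIdeal d A (j + 1) := by
    intro j
    induction j with
    | zero => exact ⟨0, zero_mem _, by simpa using hw⟩
    | succ j ih =>
      obtain ⟨u, hu, h⟩ := ih
      set p := S.compl A u with hp
      have hp1 : p ∈ tIdeal d A 1 := S.compl_mem_tIdeal hu
      -- Fixed-point iteration: each summand of the new error is a product of a term in `t^(j+1)`
      -- and one without constant term, so one order of precision is gained.
      set u' := w - p * (u - p) with hu'
      have hu'1 : u' ∈ tIdeal d A 1 := sub_mem hw (Ideal.mul_mem_right _ _ hp1)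
      have hδ : u' - u ∈ tIdeal d A (j + 1) := by
        rw [← neg_mem_iff]
        convert h using 1
        rw [hu']; ring
      have hpδ : S.compl A u' - p ∈ tIdeal d A (j + 1) := by
        rw [hp, ← map_sub]
        exact S.compl_mem_tIdeal hδ
      refine ⟨u', hu'1, ?_⟩
      have : u' + S.compl A u' * (u' - S.compl A u') - w =
          (S.compl A u' - p) * (u' - S.compl A u') +
            ((u' - u) - (S.compl A u' - p)) * p := by
        rw [hu']; ring
      rw [this]
      exact add_mem (mul_mem_tIdeal hpδ (sub_mem hu'1 (S.compl_mem_tIdeal hu'1)))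
        (mul_mem_tIdeal (sub_mem hδ hpδ) hp1)
  obtain ⟨u, hu, h⟩ := key (N - 1)
  rw [Nat.sub_add_cancel S.pos] at h
  exact ⟨u, hu, h⟩

/-- The same contraction gives injectivity: agreement modulo `t^(j+1)` improves the quadratic terms,
hence `u - u'`, by one order. -/
theorem eq_of_add_mul_compl {u u' : Fin d → A⟦X⟧} (hu : u ∈ tIdeal d A 1)
    (hu' : u' ∈ tIdeal d A 1)
    (h : u + S.compl A u * (u - S.compl A u) -
      (u' + S.compl A u' * (u' - S.compl A u')) ∈ tIdeal d A N) : u - u' ∈ tIdeal d A N := by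
  have key : ∀ j, j + 1 ≤ N → u - u' ∈ tIdeal d A (j + 1) := by
    intro j
    induction j with
    | zero => exact fun _ => sub_mem hu hu'
    | succ j ih =>
      intro hj
      have hδ := ih (by omega)
      have hpδ : S.compl A u - S.compl A u' ∈ tIdeal d A (j + 1) := by
        rw [← map_sub]
        exact S.compl_mem_tIdeal hδ
      have hp := S.compl_mem_tIdeal hu
      have hp' := S.compl_mem_tIdeal hu'
      have : u - u' = (u + S.compl A u * (u - S.compl A u) -
          (u' + S.compl A u' * (u' - S.compl A u'))) -
          ((S.compl A u - S.compl A u') * (u - S.compl A u) +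
            ((u - u') - (S.compl A u - S.compl A u')) * S.compl A u') := by ring
      rw [this]
      exact sub_mem (tIdeal_antitone hj h) (add_mem (mul_mem_tIdeal hpδ (sub_mem hu hp))
        (mul_mem_tIdeal (sub_mem hδ hpδ) hp'))
  have := key (N - 1) (by have := S.pos; omega)
  rwa [Nat.sub_add_cancel S.pos] at this

/-- The jets of the chosen complement of `𝒪_A`, without constant terms. -/
def slice (A : Type u) [CommRing A] [Algebra k A] : Set (Fin d × Fin N → A) :=
  {s | ofJet A d N s ∈ tIdeal d A 1 ∧ extendScalars A S.proj s = s}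

/-- The jets of the elements of `𝒪_A` without constant terms. -/
def radical (A : Type u) [CommRing A] [Algebra k A] : Set (Fin d × Fin N → A) :=
  {m | ofJet A d N m ∈ tIdeal d A 1 ∧ extendScalars A S.proj m = 0}

theorem ofJet_mem_family {m : Fin d × Fin N → A} (hm : m ∈ S.radical A) :
    ofJet A d N m ∈ family O A := by
  rw [S.mem_family_iff, jet_ofJet, hm.2]

/-- Expand `(1 + p(u))(1 + u - p(u)) = 1 + u + p(u)(u - p(u))` and solve for `u`; then `s` and `m`
are its two components in the splitting. -/
theorem exists_factorization {w : Fin d → A⟦X⟧} (hw : w ∈ tIdeal d A 1) :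
    ∃ s ∈ S.slice A, ∃ m ∈ S.radical A,
      (1 + ofJet A d N s) * (1 + ofJet A d N m) - (1 + w) ∈ tIdeal d A N := by
  obtain ⟨u, hu, h⟩ := S.exists_add_mul_compl hw
  have h1 : ofJet A d N (jet A d N (S.compl A u)) = S.compl A u := by
    rw [compl_apply, jet_ofJet]
  refine ⟨jet A d N (S.compl A u), ⟨?_, ?_⟩, jet A d N (u - S.compl A u), ⟨?_, ?_⟩, ?_⟩
  · rw [h1]
    exact S.compl_mem_tIdeal hu
  · have := congrArg (jet A d N) (S.compl_compl u)
    rwa [S.compl_apply (S.compl A u), jet_ofJet] at this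
  · have h2 : u - S.compl A u ∈ tIdeal d A 1 := sub_mem hu (S.compl_mem_tIdeal hu)
    have h3 := ofJet_jet_sub_mem (N := N) (u - S.compl A u)
    have := add_mem (tIdeal_antitone S.pos h3) h2
    rwa [sub_add_cancel] at this
  · rw [← S.mem_family_iff]
    exact S.sub_compl_mem_family u
  · rw [h1]
    have : (1 + S.compl A u) * (1 + ofJet A d N (jet A d N (u - S.compl A u))) - (1 + w) =
        (1 + S.compl A u) * (ofJet A d N (jet A d N (u - S.compl A u)) - (u - S.compl A u)) +
          (u + S.compl A u * (u - S.compl A u) - w) := by ring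
    rw [this]
    exact add_mem (Ideal.mul_mem_left _ _ (ofJet_jet_sub_mem _)) h

/-- Apply the injectivity to `u = s + m`, from which `p` recovers `s`. The factors `m`, `m'` are
power series rather than jets, as needed for comparing two representatives of a class. -/
theorem factorization_unique {s s' : Fin d × Fin N → A} {m m' : Fin d → A⟦X⟧}
    (hs : s ∈ S.slice A) (hs' : s' ∈ S.slice A) (hm : m ∈ family O A) (hm1 : m ∈ tIdeal d A 1)
    (hm' : m' ∈ family O A) (hm1' : m' ∈ tIdeal d A 1)
    (h : (1 + ofJet A d N s) * (1 + m) - (1 + ofJet A d N s') * (1 + m') ∈ tIdeal d A N) :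
    s = s' ∧ m - m' ∈ tIdeal d A N := by
  have e1 : S.compl A (ofJet A d N s + m) = ofJet A d N s := by
    rw [map_add, compl_ofJet, hs.2, (S.mem_family_iff_compl m).mp hm, add_zero]
  have e2 : S.compl A (ofJet A d N s' + m') = ofJet A d N s' := by
    rw [map_add, compl_ofJet, hs'.2, (S.mem_family_iff_compl m').mp hm', add_zero]
  have h1 := S.eq_of_add_mul_compl (add_mem hs.1 hm1) (add_mem hs'.1 hm1') (by
    rw [e1, e2]
    convert h using 1
    ring)
  have h2 := S.compl_eq_of_sub_mem h1
  rw [e1, e2] at h2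
  have h3 := congrArg (jet A d N) h2
  rw [jet_ofJet, jet_ofJet] at h3
  refine ⟨h3, ?_⟩
  rw [h3] at h1
  simpa using h1

end JetSplitting
end CurveSing

namespace CurveSing

/-! ### Normal forms and representability of `𝒥` -/

variable {k : Type u} [Field k] {d N : ℕ}

theorem JPoints.map_comp (O : Subalgebra k (Fin d → k⟦X⟧)) {A B C : Type u} [CommRing A]
    [Algebra k A] [CommRing B] [Algebra k B] [CommRing C] [Algebra k C] (f : A →ₐ[k] B)
    (g : B →ₐ[k] C) (q : JPoints O A) :
    JPoints.map O (g.comp f) q = JPoints.map O g (JPoints.map O f q) := by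
  obtain ⟨μ, rfl⟩ := QuotientGroup.mk_surjective q
  change QuotientGroup.mk _ = QuotientGroup.mk _
  congr 1

/-- The coordinates of the normal forms of the classes in `𝒥`: the values at `0`, their inverses,
and a jet. -/
abbrev NormalFormIndex (d N : ℕ) : Type := (Fin d ⊕ Fin d) ⊕ (Fin d × Fin N)

/-- The tuple `x (1 + s)`. -/
noncomputable def normalTuple {A : Type u} [CommRing A] (v : NormalFormIndex d N → A) :
    Fin d → A⟦X⟧ :=
  (fun i => C (v (.inl (.inl i)))) * (1 + ofJet A d N fun e => v (.inr e))

theorem mapCoeff_normalTuple {A B : Type u} [CommRing A] [CommRing B] (f : A →+* B)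
    (v : NormalFormIndex d N → A) :
    mapCoeff d f (normalTuple v) = normalTuple fun e => f (v e) := by
  rw [normalTuple, map_mul, map_add, map_one, mapCoeff_ofJet]
  congr 1
  funext i
  simp [mapCoeff_apply]

theorem mapCoeff_tPow {A B : Type u} [CommRing A] [CommRing B] (f : A →+* B) (n : Fin d → ℕ) :
    mapCoeff d f (tPow A n) = tPow B n := by
  funext i
  simp [mapCoeff_apply, tPow]

namespace JetSplitting

variable {O : Subalgebra k (Fin d → k⟦X⟧)} (S : JetSplitting O N)

/-- The normal forms `x (1 + s)` of the classes in `𝒥`. -/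
def normalForms (i₀ : Fin d) : PointSet k (NormalFormIndex d N) := fun A _ _ =>
  {v | (∀ i, v (.inl (.inl i)) * v (.inl (.inr i)) = 1) ∧ v (.inl (.inl i₀)) = 1 ∧
    (fun e => v (.inr e)) ∈ S.slice A}

theorem exists_represents_normalForms (i₀ : Fin d) :
    ∃ (B : Type u) (_ : CommRing B) (_ : Algebra k B) (_ : Algebra.FiniteType k B)
      (b : NormalFormIndex d N → B), Represents (S.normalForms i₀) B b := by
  let f : ∀ (A : Type u) [CommRing A] [Algebra k A], (NormalFormIndex d N → A) →
      ((Fin d ⊕ Unit) ⊕ (Fin d ⊕ (Fin d × Fin N)) → A) := fun A _ _ v =>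
    Sum.elim (Sum.elim (fun i => v (.inl (.inl i)) * v (.inl (.inr i)) - 1)
      (fun _ => v (.inl (.inl i₀)) - 1))
      (Sum.elim (fun i => v (.inr (i, ⟨0, S.pos⟩)))
        (fun e => extendScalars A S.proj (fun e => v (.inr e)) e - v (.inr e)))
  have hf : IsNaturalOn (fun _ _ _ => Set.univ) f := by
    intro A A' _ _ _ _ φ v _
    funext e
    rcases e with (e | e) | (e | e)
    · simp [f]
    · simp [f]
    · simp [f]
    · simp [f, extendScalars_naturality]
  have h := (represents_univ (k := k) (NormalFormIndex d N)).vanishing f hf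
  refine ⟨_, _, _, inferInstance, _, Represents.map (Y := S.normalForms i₀) h (fun _ _ _ v => v)
    (fun _ _ _ _ _ _ _ _ _ => rfl) fun A _ _ => ?_⟩
  suffices heq : {v | v ∈ Set.univ ∧ ∀ e, f A v e = 0} = S.normalForms i₀ A by
    rw [← heq]; exact Set.bijOn_id _
  ext v
  simp only [normalForms, slice, ofJet_mem_tIdeal, Nat.lt_one_iff, Set.mem_univ, true_and,
    Sum.forall, f, Sum.elim_inl, Sum.elim_inr, sub_eq_zero, Set.mem_ofPred_eq, forall_const]
  constructor
  · rintro ⟨⟨h1, h2⟩, h3, h4⟩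
    refine ⟨h1, h2, fun i m hm => ?_, funext h4⟩
    have : m = ⟨0, S.pos⟩ := Fin.ext hm
    rw [this, h3]
  · rintro ⟨h1, h2, h3, h4⟩
    exact ⟨⟨h1, h2⟩, fun i => h3 i _ rfl, fun e => congrFun h4 e⟩

variable {A : Type u} [CommRing A] [Algebra k A] {i₀ : Fin d}

theorem constantCoeff_normalTuple {v : NormalFormIndex d N → A} (hv : v ∈ S.normalForms i₀ A)
    (i : Fin d) : constantCoeff (normalTuple v i) = v (.inl (.inl i)) := by
  have h := mem_tIdeal_one.mp hv.2.2.1 i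
  simp [normalTuple, h]

theorem isUnit_normalTuple {v : NormalFormIndex d N → A} (hv : v ∈ S.normalForms i₀ A) :
    IsUnit (normalTuple v) := by
  rw [isUnit_tuple_iff]
  intro i
  rw [S.constantCoeff_normalTuple hv]
  exact IsUnit.of_mul_eq_one _ (hv.1 i)

theorem isUnit_one_add {w : Fin d → A⟦X⟧} (hw : w ∈ tIdeal d A 1) : IsUnit (1 + w) := by
  rw [isUnit_tuple_iff]
  intro i
  simp [mem_tIdeal_one.mp hw i]

/-- Factor out the constant terms `c_i` and split the remaining `1 + w`. The common scalar `c_{i₀}`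
belongs to `𝒪_A` and moves into `h`, which normalizes `x_{i₀} = 1`. -/
theorem exists_normalForm [IsLocalRing O] (μ : (Fin d → A⟦X⟧)ˣ) :
    ∃ v ∈ S.normalForms i₀ A, ∃ h ∈ family O A, normalTuple v * h = μ := by
  have hμ := isUnit_tuple_iff.mp μ.isUnit
  choose c hc using hμ
  let x : Fin d → Aˣ := fun i => c i * (c i₀)⁻¹
  let w : Fin d → A⟦X⟧ := (fun i => C (↑(c i)⁻¹ : A)) * μ - 1
  have hw : w ∈ tIdeal d A 1 := by
    rw [mem_tIdeal_one]
    intro i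
    simp [w, ← hc i]
  obtain ⟨s, hs, m, hm, hsm⟩ := S.exists_factorization hw
  obtain ⟨g, hg⟩ := isUnit_one_add hs.1
  -- The factorization holds only modulo `t^N`, so `h` is defined by exact division; it differs from
  -- `1 + m` by an element of the conductor.
  let h : Fin d → A⟦X⟧ := (↑g⁻¹ : Fin d → A⟦X⟧) * (1 + w)
  have hh : h ∈ family O A := by
    have h1 : h = (1 + ofJet A d N m) -
        (↑g⁻¹ : Fin d → A⟦X⟧) * ((1 + ofJet A d N s) * (1 + ofJet A d N m) - (1 + w)) := by
      rw [mul_sub, ← mul_assoc, ← hg, Units.inv_mul, one_mul]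
      simp only [h]; ring
    rw [h1]
    exact sub_mem (add_mem (one_mem _) (S.ofJet_mem_family hm))
      (S.tIdeal_le_family (Ideal.mul_mem_left _ _ hsm))
  refine ⟨Sum.elim (Sum.elim (fun i => (x i : A)) (fun i => (↑(x i)⁻¹ : A))) s,
    ⟨fun i => (x i).mul_inv, by simp [x], hs⟩, (c i₀ : A) • h, Subalgebra.smul_mem _ hh _, ?_⟩
  have h2 : (1 + ofJet A d N s) * h = 1 + w := by
    simp only [h]
    rw [← mul_assoc, ← hg, Units.mul_inv, one_mul]
  have h3 : (fun i => C (x i : A) : Fin d → A⟦X⟧) = (↑(c i₀)⁻¹ : A) • fun i => C (c i : A) := by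
    funext i
    simp [x, mul_comm, smul_eq_C_mul]
  have h4 : (fun i => C (c i : A) : Fin d → A⟦X⟧) * (1 + w) = μ := by
    funext i
    simp only [w, add_sub_cancel, Pi.mul_apply]
    rw [← mul_assoc, ← map_mul, Units.mul_inv, map_one, one_mul]
  change (fun i => C (x i : A) : Fin d → A⟦X⟧) * (1 + ofJet A d N s) * ((c i₀ : A) • h) = μ
  rw [mul_smul_comm, mul_assoc, h2, h3, smul_mul_assoc, h4, smul_smul, Units.mul_inv, one_smul]

/-- Comparing constant terms identifies `x`, and so its inverse; dividing by `x` reduces to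
`factorization_unique`. -/
theorem normalForm_unique [IsLocalRing O] {v v' : NormalFormIndex d N → A}
    (hv : v ∈ S.normalForms i₀ A) (hv' : v' ∈ S.normalForms i₀ A) {m m' : Fin d → A⟦X⟧}
    (hm : m ∈ family O A) (hm1 : m ∈ tIdeal d A 1)
    (hm' : m' ∈ family O A) (hm1' : m' ∈ tIdeal d A 1)
    (h : normalTuple v * (1 + m) - normalTuple v' * (1 + m') ∈ tIdeal d A N) :
    v = v' ∧ m - m' ∈ tIdeal d A N := by
  have hx : ∀ i, v (.inl (.inl i)) = v' (.inl (.inl i)) := by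
    intro i
    have h1 := mem_tIdeal_one.mp (tIdeal_antitone S.pos h) i
    have e := mem_tIdeal_one.mp hm1 i
    have e' := mem_tIdeal_one.mp hm1' i
    simpa [S.constantCoeff_normalTuple hv, S.constantCoeff_normalTuple hv', e, e', sub_eq_zero]
      using h1
  have hy : ∀ i, v (.inl (.inr i)) = v' (.inl (.inr i)) := by
    intro i
    have h1 := hv.1 i
    have h2 := hv'.1 i
    rw [← hx i] at h2
    exact (IsUnit.of_mul_eq_one _ h1).mul_left_cancel (h1.trans h2.symm)
  have h2 : (1 + ofJet A d N fun e => v (.inr e)) * (1 + m) -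
      (1 + ofJet A d N fun e => v' (.inr e)) * (1 + m') =
      (fun i => C (v (.inl (.inr i)))) *
        (normalTuple v * (1 + m) - normalTuple v' * (1 + m')) := by
    funext i
    simp only [normalTuple, Pi.mul_apply, Pi.sub_apply, ← hx i]
    rw [mul_sub, ← mul_assoc, ← mul_assoc, ← mul_assoc, ← mul_assoc, ← map_mul,
      mul_comm (v _), hv.1 i]
    simp
  have h3 := S.factorization_unique hv.2.2 hv'.2.2 hm hm1 hm' hm1' (by
    rw [h2]; exact Ideal.mul_mem_left _ _ h)
  refine ⟨?_, h3.2⟩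
  funext e
  rcases e with (e | e) | e
  · exact hx e
  · exact hy e
  · exact congrFun h3.1 e

/-- `𝒥` is represented by the algebra that represents the normal forms. -/
theorem existsUnique_map_eq [IsLocalRing O] {B : Type u} [CommRing B] [Algebra k B]
    {b : NormalFormIndex d N → B} (hb : Represents (S.normalForms i₀) B b)
    (q : JPoints O A) :
    ∃! φ : B →ₐ[k] A,
      JPoints.map O φ (QuotientGroup.mk (S.isUnit_normalTuple hb.mem_self).unit) = q := by
  have hmap : ∀ (φ : B →ₐ[k] A),
      JPoints.map O φ (QuotientGroup.mk (S.isUnit_normalTuple hb.mem_self).unit) =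
        QuotientGroup.mk (S.isUnit_normalTuple (hb.mem A φ)).unit := by
    intro φ
    change QuotientGroup.mk _ = QuotientGroup.mk _
    congr 1
    apply Units.ext
    exact mapCoeff_normalTuple φ.toRingHom b
  obtain ⟨μ, rfl⟩ := QuotientGroup.mk_surjective q
  obtain ⟨v, hv, h, hh, he⟩ := S.exists_normalForm (i₀ := i₀) μ
  obtain ⟨φ, hφ⟩ := hb.exists_lift A v hv
  obtain rfl : v = fun e => φ (b e) := funext fun e => (hφ e).symm
  refine ⟨φ, ?_, fun ψ hψ => ?_⟩
  · change JPoints.map O φ _ = _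
    rw [hmap, S.mk_eq_mk_iff]
    exact ⟨h, hh, he⟩
  · change JPoints.map O ψ _ = _ at hψ
    rw [hmap, S.mk_eq_mk_iff] at hψ
    obtain ⟨h', hh', he'⟩ := hψ
    have hk : IsUnit h := isUnit_of_mul_isUnit_right (he ▸ μ.isUnit)
    obtain ⟨g, rfl⟩ := hk
    have hg : (↑g⁻¹ : Fin d → A⟦X⟧) ∈ family O A := S.inverse_mem_family hh g.mul_inv
    -- The quotient of the two comparison factors lies in `𝒪_A`. Its constant term is `1` at `i₀` by
    -- the normalization, hence everywhere by locality, so `r = 1 + m` with `m` admissible in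
    -- `normalForm_unique`.
    set r := h' * (↑g⁻¹ : Fin d → A⟦X⟧) with hr
    have hrm : r ∈ family O A := mul_mem hh' hg
    have e1 : normalTuple (fun e => ψ (b e)) * r = normalTuple fun e => φ (b e) := by
      have e2 : normalTuple (fun e => ψ (b e)) * h' = normalTuple (fun e => φ (b e)) * g :=
        he'.trans he.symm
      rw [hr, ← mul_assoc, e2, mul_assoc, Units.mul_inv, mul_one]
    have hr1 : r - 1 ∈ tIdeal d A 1 := by
      have e3 : constantCoeff (r i₀) = 1 := by
        have := congrArg (fun z => constantCoeff (z i₀)) e1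
        simpa [S.constantCoeff_normalTuple (hb.mem A φ), S.constantCoeff_normalTuple (hb.mem A ψ),
          (hb.mem A φ).2.1, (hb.mem A ψ).2.1] using this
      rw [mem_tIdeal_one]
      intro i
      simp [constantCoeff_eq_of_mem_family hrm i i₀, e3]
    have h5 := S.normalForm_unique (hb.mem A ψ) (hb.mem A φ) (m := r - 1) (m' := 0)
      (sub_mem hrm (one_mem _)) hr1 (zero_mem _) (zero_mem _) (by
        rw [add_sub_cancel, e1]; simp)
    exact hb.unique A _ _ fun e => congrFun h5.1 e

include S in
theorem nonempty_JVariety [IsLocalRing O] (i₀ : Fin d) : Nonempty (JVariety O) := by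
  obtain ⟨B, _, _, _, b, hb⟩ := S.exists_represents_normalForms i₀
  let q₀ : JPoints O B := QuotientGroup.mk (S.isUnit_normalTuple hb.mem_self).unit
  have hbij : ∀ (A : Type u) [CommRing A] [Algebra k A],
      Function.Bijective fun φ : B →ₐ[k] A => JPoints.map O φ q₀ := fun A _ _ =>
    Function.bijective_iff_existsUnique _ |>.mpr fun q => S.existsUnique_map_eq hb q
  exact ⟨{
    V := affVar k B
    points := fun A _ _ => specOverEquiv.trans (Equiv.ofBijective _ (hbij A))
    natural := fun {A A'} _ _ _ _ f x => by
      change JPoints.map O (specOverEquiv (specOverMap f ≫ x)) q₀ =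
        JPoints.map O f (JPoints.map O (specOverEquiv x) q₀)
      rw [← JPoints.map_comp]
      exact congr(JPoints.map O $(specOverEquiv_comp f x) q₀) }⟩

/-! ### The closed locus `ℐ_n` in `𝒥` -/

/-- The normal forms `μ` with `t^n μ ∈ 𝒪_A`. -/
def principalForms (i₀ : Fin d) (n : Fin d → ℕ) : PointSet k (NormalFormIndex d N) :=
  fun A _ _ => {v | v ∈ S.normalForms i₀ A ∧
    ∀ e, extendScalars A S.proj (jet A d N (tPow A n * normalTuple v)) e = 0}

theorem mem_principalForms {n : Fin d → ℕ} {v : NormalFormIndex d N → A} :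
    v ∈ S.principalForms i₀ n A ↔
      v ∈ S.normalForms i₀ A ∧ tPow A n * normalTuple v ∈ family O A := by
  rw [S.mem_family_iff, funext_iff]
  rfl

/-- Representatives of a class differ by elements of `𝒪_K`, so the condition `t^n μ ∈ 𝒪_K` can be
tested on the normal form; the values are then `n` because `μ` is a unit. -/
theorem mem_sigma_iff [IsLocalRing O] {K : Type u} [Field K] [Algebra k K] (n : Fin d → ℕ)
    {v : NormalFormIndex d N → K} (hv : v ∈ S.normalForms i₀ K) :
    (∃ I ∈ principalIdeals O n K,
      IsSigma O n K I (QuotientGroup.mk (S.isUnit_normalTuple hv).unit)) ↔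
      v ∈ S.principalForms i₀ n K := by
  rw [S.mem_principalForms]
  constructor
  · rintro ⟨I, -, μ, z, hz, -, hq⟩
    refine ⟨hv, ?_⟩
    obtain ⟨h, hh, he⟩ := (S.mk_eq_mk_iff _ _).mp hq.symm
    rw [IsUnit.unit_spec] at he
    rw [← he, ← mul_assoc, ← hz]
    exact mul_mem z.2 hh
  · rintro ⟨-, h⟩
    refine ⟨Ideal.span {⟨_, h⟩}, ⟨⟨_, h⟩, fun i => ?_, rfl⟩,
      (S.isUnit_normalTuple hv).unit, ⟨_, h⟩, rfl, rfl, rfl⟩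
    have hu : IsUnit (normalTuple v i) := Pi.isUnit_iff.mp (S.isUnit_normalTuple hv) i
    simp [tPow, order_mul, order_zero_of_unit hu]

include S in
/-- The subset `ℐ_n` of `𝒥` is closed, and its class is that of the variety of the normal forms
`μ` with `t^n μ ∈ 𝒪`. -/
theorem exists_hasClass_sigmaImage [IsLocalRing O] (i₀ : Fin d) (J : JVariety O)
    (n : Fin d → ℕ) :
    ∃ hclosed : IsClosed (sigmaImage J n),
      HasClass (S.principalForms i₀ n) (J.V.ofClosed (sigmaImage J n) hclosed).cls₀ := by
  obtain ⟨B, _, _, _, b, hb⟩ := S.exists_represents_normalForms i₀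
  set q₀ : JPoints O B := QuotientGroup.mk (S.isUnit_normalTuple hb.mem_self).unit with hq₀
  -- The universal normal form defines an isomorphism of `Spec B` with the given `J`, so the choice
  -- of the representing variety does not matter.
  let f : specOver k B ⟶ J.V.X := (J.points B).symm q₀
  have hf : ∀ (A : Type u) [CommRing A] [Algebra k A] (φ : B →ₐ[k] A),
      J.points A (specOverMap φ ≫ f) = JPoints.map O φ q₀ := by
    intro A _ _ φ
    rw [J.natural, Equiv.apply_symm_apply]
  have hf' : ∀ (A : Type u) [CommRing A] [Algebra k A] (x : specOver k A ⟶ J.V.X),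
      ∃! φ : B →ₐ[k] A, specOverMap φ ≫ f = x := by
    intro A _ _ x
    obtain ⟨φ, h1, h2⟩ := S.existsUnique_map_eq hb (J.points A x)
    refine ⟨φ, (J.points A).injective ((hf A φ).trans h1), fun ψ hψ => h2 ψ ?_⟩
    change JPoints.map O ψ q₀ = _
    rw [← hf, ← hψ]
  have hiso : IsIso f := isIso_of_bijective_points f hf'
  have hnat : IsNaturalOn (S.normalForms i₀) fun A _ _ v =>
      extendScalars A S.proj (jet A d N (tPow A n * normalTuple v)) := by
    intro A A' _ _ _ _ φ v _
    change extendScalars A' S.proj (jet A' d N (tPow A' n *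
      normalTuple fun e => φ.toRingHom (v e))) = _
    rw [← extendScalars_naturality, ← mapCoeff_normalTuple φ.toRingHom v,
      ← mapCoeff_tPow φ.toRingHom n, ← map_mul, jet_mapCoeff]
    rfl
  have hrep := hb.vanishing _ hnat
  set 𝔞 := Ideal.span (Set.range (extendScalars B S.proj (jet B d N (tPow B n * normalTuple b))))
  let π : B →ₐ[k] B ⧸ 𝔞 := Ideal.Quotient.mkₐ k 𝔞
  let i : (affVar k (B ⧸ 𝔞)).X ⟶ J.V.X := specOverMap π ≫ f
  have hi : IsClosedImmersion i.left := by
    have h1 : IsClosedImmersion (specOverMap π).left :=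
      specOverMap_left_isClosedImmersion π Ideal.Quotient.mk_surjective
    have h2 : IsIso f.left := inferInstanceAs (IsIso ((Over.forget _).map f))
    exact inferInstanceAs (IsClosedImmersion ((specOverMap π).left ≫ f.left))
  have key : ∀ (K : Type u) [Field K] [Algebra k K] (φ : B →ₐ[k] K),
      (∃ I ∈ principalIdeals O n K, IsSigma O n K I (J.points K (specOverMap φ ≫ f))) ↔
        ∃ ψ : B ⧸ 𝔞 →ₐ[k] K, ψ.comp π = φ := by
    intro K _ _ φ
    have e : J.points K (specOverMap φ ≫ f) =
        QuotientGroup.mk (S.isUnit_normalTuple (hb.mem K φ)).unit := by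
      rw [hf]
      change QuotientGroup.mk _ = QuotientGroup.mk _
      congr 1
      apply Units.ext
      exact mapCoeff_normalTuple φ.toRingHom b
    rw [e, S.mem_sigma_iff n (hb.mem K φ)]
    constructor
    · intro h
      obtain ⟨ψ, hψ⟩ := hrep.exists_lift K _ h
      exact ⟨ψ, hb.unique K _ _ fun e => hψ e⟩
    · rintro ⟨ψ, rfl⟩
      exact hrep.mem K ψ
  have hrange : Set.range i.left = sigmaImage J n := by
    apply Set.Subset.antisymm
    · rintro _ ⟨y, rfl⟩
      -- A point of the closed subscheme is seen by the field-valued point of its own residue field,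
      -- as the image of the zero ideal.
      let 𝔭 : PrimeSpectrum (B ⧸ 𝔞) := y
      let ψ : B ⧸ 𝔞 →ₐ[k] 𝔭.asIdeal.ResidueField := IsScalarTower.toAlgHom k _ _
      obtain ⟨I, hI, hI'⟩ := (key 𝔭.asIdeal.ResidueField (ψ.comp π)).mpr ⟨ψ, rfl⟩
      refine ⟨𝔭.asIdeal.ResidueField, inferInstance, inferInstance, _, I, hI, hI', ?_⟩
      have hy : (y : PrimeSpectrum (B ⧸ 𝔞)) ∈ Set.range (specOverMap ψ).left := by
        rw [range_specOverMap_left]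
        refine ⟨⊥, ?_⟩
        ext x
        change ψ x ∈ (⊥ : Ideal _) ↔ x ∈ 𝔭.asIdeal
        exact Ideal.algebraMap_residueField_eq_zero
      obtain ⟨x, hx⟩ := hy
      refine ⟨x, ?_⟩
      rw [specOverMap_comp]
      rw [← hx]
      rfl
    · rintro x ⟨K, _, _, p, I, hI, hI', hx⟩
      obtain ⟨φ, rfl, -⟩ := hf' K p
      obtain ⟨ψ, rfl⟩ := (key K φ).mp ⟨I, hI, hI'⟩
      obtain ⟨y, rfl⟩ := hx
      refine ⟨(specOverMap ψ).left y, ?_⟩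
      rw [specOverMap_comp]
      rfl
  have hclosed : IsClosed (sigmaImage J n) := by
    rw [← hrange]
    exact i.left.isClosedEmbedding.isClosed_range
  refine ⟨hclosed, ?_⟩
  rw [ofClosed_cls₀_eq i hclosed hrange]
  exact ⟨_, _, _, inferInstance, _, hrep, rfl⟩

end JetSplitting
end CurveSing

namespace CurveSing

/-! ### Dimension count for jets -/

section Dimension

/-- If `ker f ⊆ J`, then `f` induces an isomorphism `M/J ≅ f(M)/f(J)`. -/
theorem finrank_range_eq_of_ker_le {k M W : Type*} [Field k] [AddCommGroup M] [Module k M]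
    [AddCommGroup W] [Module k W] [FiniteDimensional k W] (f : M →ₗ[k] W) (J : Submodule k M)
    (h : LinearMap.ker f ≤ J) :
    Module.finrank k (LinearMap.range f) = Module.finrank k (J.map f) + Module.finrank k (M ⧸ J) := by
  let g : M →ₗ[k] W ⧸ J.map f := (J.map f).mkQ ∘ₗ f
  have hg : LinearMap.ker g = J := by
    rw [LinearMap.ker_comp, Submodule.ker_mkQ, Submodule.comap_map_eq, sup_eq_left.mpr h]
  have h1 : Module.finrank k (M ⧸ J) = Module.finrank k (LinearMap.range g) :=
    (Submodule.quotEquivOfEq _ _ hg).finrank_eq.symm.trans g.quotKerEquivRange.finrank_eq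
  let r : LinearMap.range f →ₗ[k] W ⧸ J.map f := (J.map f).mkQ ∘ₗ (LinearMap.range f).subtype
  have h2 := r.finrank_range_add_finrank_ker
  have h3 : LinearMap.range r = LinearMap.range g := by
    rw [LinearMap.range_comp, LinearMap.range_comp, Submodule.range_subtype]
  have h4 : Module.finrank k (LinearMap.ker r) = Module.finrank k (J.map f) := by
    rw [LinearMap.ker_comp, Submodule.ker_mkQ]
    exact (Submodule.comapSubtypeEquivOfLe LinearMap.map_le_range).finrank_eq
  rw [← h2, h3, h4, h1, add_comm]

variable {k : Type u} [Field k] {d N : ℕ}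

/-- The coefficients of order less than `a i` of the `i`-th component. -/
noncomputable def lowCoeffs (k : Type u) [Field k] (a : Fin d → ℕ) :
    (Fin d → k⟦X⟧) →ₗ[k] ((Σ i, Fin (a i)) → k) :=
  LinearMap.pi fun e => coeff e.2 ∘ₗ LinearMap.proj e.1

theorem lowCoeffs_eq_zero_iff {a : Fin d → ℕ} {z : Fin d → k⟦X⟧} :
    lowCoeffs k a z = 0 ↔ ∀ i, X ^ a i ∣ z i := by
  simp only [X_pow_dvd_iff]
  constructor
  · intro h i m hm
    exact congrFun h ⟨i, ⟨m, hm⟩⟩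
  · intro h
    funext ⟨i, m⟩
    exact h i m m.2

theorem lowCoeffs_surjective (a : Fin d → ℕ) : Function.Surjective (lowCoeffs k a) := by
  intro v
  refine ⟨fun i => PowerSeries.mk fun m => if h : m < a i then v ⟨i, ⟨m, h⟩⟩ else 0, ?_⟩
  funext ⟨i, m⟩
  simp [lowCoeffs]

theorem mem_valIdeal_iff {O : Subalgebra k (Fin d → k⟦X⟧)} {m : Fin d → ℕ} {z : O} :
    z ∈ valIdeal O m ↔ ∀ i, X ^ m i ∣ (z : Fin d → k⟦X⟧) i := by
  refine forall_congr' fun i => ?_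
  rw [X_pow_dvd_iff]
  exact ⟨fun h j hj => coeff_of_lt_order j (lt_of_lt_of_le (by exact_mod_cast hj) h),
    fun h => nat_le_order _ _ h⟩

theorem colength_eq (O : Subalgebra k (Fin d → k⟦X⟧)) (m : Fin d → ℕ) :
    colength O m = Module.finrank k (O ⧸ (valIdeal O m).restrictScalars k) :=
  (Submodule.Quotient.restrictScalarsEquiv k (valIdeal O m)).finrank_eq.symm

/-- By locality the quotient is detected by a single constant term, so it is `k`. With `n = 0` in
`finrank_jetSpace` this gives the dimension `h` of the jets of the maximal ideal. -/
theorem colength_maximal (O : Subalgebra k (Fin d → k⟦X⟧)) [IsLocalRing O] (i₀ : Fin d) :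
    colength O (0 + indicatorVec Finset.univ) = 1 := by
  let f : O →ₗ[k] k := coeff 0 ∘ₗ LinearMap.proj i₀ ∘ₗ (Subalgebra.toSubmodule O).subtype
  have hf : Function.Surjective f := by
    intro c
    refine ⟨algebraMap k O c, ?_⟩
    change coeff 0 (C c : k⟦X⟧) = c
    simp
  have hker : LinearMap.ker f = (valIdeal O (0 + indicatorVec Finset.univ)).restrictScalars k := by
    ext z
    rw [LinearMap.mem_ker, Submodule.restrictScalars_mem, mem_valIdeal_iff]
    have h1 : ∀ i, X ^ (0 + indicatorVec (Finset.univ : Finset (Fin d))) i ∣ (z : Fin d → k⟦X⟧) i ↔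
        constantCoeff ((z : Fin d → k⟦X⟧) i) = 0 := by
      intro i
      simp [indicatorVec, X_dvd_iff]
    simp only [h1]
    have h2 : f z = constantCoeff ((z : Fin d → k⟦X⟧) i₀) := coeff_zero_eq_constantCoeff_apply _
    rw [h2]
    exact ⟨fun h i => (constantCoeff_eq_of_mem z.2 i i₀).trans h, fun h => h i₀⟩
  rw [colength_eq, ← hker, (f.quotKerEquivOfSurjective hf).finrank_eq, Module.finrank_self]

variable {O : Subalgebra k (Fin d → k⟦X⟧)} (S : JetSplitting O N)

namespace JetSplitting

/-- The jets `μ` such that `t^n μ ∈ 𝒪` and `μ_i(0) = 0` for `i ∈ I`. -/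
noncomputable def jetSpace (n : Fin d → ℕ) (I : Finset (Fin d)) : Submodule k (Fin d × Fin N → k) :=
  (Subalgebra.toSubmodule O).comap (LinearMap.mulLeft k (tPow k n) ∘ₗ ofJet k d N) ⊓
    ⨅ i ∈ I, LinearMap.ker (LinearMap.proj (R := k) (φ := fun _ => k) (i, (⟨0, S.pos⟩ : Fin N)))

theorem mem_jetSpace {n : Fin d → ℕ} {I : Finset (Fin d)} {v : Fin d × Fin N → k} :
    v ∈ S.jetSpace n I ↔ tPow k n * ofJet k d N v ∈ O ∧ ∀ i ∈ I, v (i, ⟨0, S.pos⟩) = 0 := by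
  simp [jetSpace, Submodule.mem_iInf]

/-- Truncate the `i`-th component at order `n_i + N`, leaving a space of dimension `‖n‖ + dN`. There
the image of `𝒪` has codimension `dim 𝒪̃/𝒪`, inside it the image of `J_{n + 1_I}` has codimension
`l(n + 1_I)`, and `μ ↦ t^n μ` identifies the jet space with the latter image. -/
theorem finrank_jetSpace [Module.Finite k ((Fin d → k⟦X⟧) ⧸ Subalgebra.toSubmodule O)]
    (n : Fin d → ℕ) (I : Finset (Fin d)) :
    Module.finrank k (S.jetSpace n I) + colength O (n + indicatorVec I) +
      Module.finrank k ((Fin d → k⟦X⟧) ⧸ Subalgebra.toSubmodule O) = norm₁ n + d * N := by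
  let a : Fin d → ℕ := fun i => n i + N
  let π := lowCoeffs k a
  have hN : ∀ z : Fin d → k⟦X⟧, (∀ i, X ^ a i ∣ z i) → z ∈ O := fun z hz =>
    S.conductor z (mem_tIdeal.mpr fun i => (pow_dvd_pow _ (Nat.le_add_left _ _)).trans (hz i))
  -- The kernel of the truncation lies in `𝒪` by the conductor, and below also in `J_{n + 1_I}`
  -- because `N ≥ 1`.
  have h1 := finrank_range_eq_of_ker_le π (Subalgebra.toSubmodule O) fun z hz =>
    hN z (lowCoeffs_eq_zero_iff.mp hz)
  rw [LinearMap.range_eq_top.mpr (lowCoeffs_surjective a), finrank_top,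
    Module.finrank_fintype_fun_eq_card, Fintype.card_sigma] at h1
  simp only [Fintype.card_fin, a, Finset.sum_add_distrib, Finset.sum_const, Finset.card_univ,
    smul_eq_mul] at h1
  let J := (valIdeal O (n + indicatorVec I)).restrictScalars k
  have h2 := finrank_range_eq_of_ker_le (π ∘ₗ (Subalgebra.toSubmodule O).subtype) J (by
    intro z hz
    have hz' := lowCoeffs_eq_zero_iff.mp (LinearMap.mem_ker.mp hz)
    refine mem_valIdeal_iff.mpr fun i => (pow_dvd_pow _ ?_).trans (hz' i)
    have := S.pos
    simp only [Pi.add_apply, indicatorVec, a]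
    split_ifs <;> omega)
  rw [LinearMap.range_comp, Submodule.range_subtype] at h2
  let ρ := π ∘ₗ LinearMap.mulLeft k (tPow k n) ∘ₗ ofJet k d N
  have hρ : Function.Injective ρ := by
    rw [injective_iff_map_eq_zero]
    intro v hv
    have hv' := lowCoeffs_eq_zero_iff.mp (show lowCoeffs k a (tPow k n * ofJet k d N v) = 0 from hv)
    have h3 : ofJet k d N v ∈ tIdeal d k N := by
      rw [mem_tIdeal]
      intro i
      have := hv' i
      simp only [a, pow_add] at this
      exact (mul_dvd_mul_iff_left (pow_ne_zero _ X_ne_zero)).mp this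
    rw [← jet_eq_zero_iff, jet_ofJet] at h3
    exact h3
  have h3 : (S.jetSpace n I).map ρ = J.map (π ∘ₗ (Subalgebra.toSubmodule O).subtype) := by
    apply le_antisymm
    · rintro _ ⟨v, hv, rfl⟩
      obtain ⟨hv1, hv2⟩ := S.mem_jetSpace.mp hv
      refine ⟨⟨_, hv1⟩, mem_valIdeal_iff.mpr fun i => ?_, rfl⟩
      simp only [Pi.add_apply, pow_add, Pi.mul_apply, tPow, indicatorVec]
      refine mul_dvd_mul_left _ ?_
      split_ifs with hi
      · rw [pow_one, X_dvd_iff, ← coeff_zero_eq_constantCoeff_apply, coeff_ofJet, dif_pos S.pos]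
        exact hv2 i hi
      · simp
    · rintro _ ⟨⟨z, hzO⟩, hz, rfl⟩
      have hz' := mem_valIdeal_iff.mp hz
      choose y hy using fun i => (pow_dvd_pow (X : k⟦X⟧)
        (show n i ≤ (n + indicatorVec I) i from Nat.le_add_right _ _)).trans (hz' i)
      have hzy : z = tPow k n * y := funext hy
      have hd : ∀ i, X ^ a i ∣ (tPow k n * ofJet k d N (jet k d N y) - z) i := by
        intro i
        have h4 : (tPow k n * ofJet k d N (jet k d N y) - z) i =
            X ^ n i * (ofJet k d N (jet k d N y) - y) i := by
          rw [hzy]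
          simp only [Pi.sub_apply, Pi.mul_apply, tPow]; ring
        rw [h4]
        simp only [a, pow_add]
        exact mul_dvd_mul_left _ (mem_tIdeal.mp (ofJet_jet_sub_mem y) i)
      refine ⟨jet k d N y, S.mem_jetSpace.mpr ⟨?_, fun i hi => ?_⟩, ?_⟩
      · have := O.add_mem (hN _ hd) hzO
        rwa [sub_add_cancel] at this
      · have h5 := hz' i
        rw [hy i] at h5
        simp only [Pi.add_apply, indicatorVec, if_pos hi, pow_add, pow_one] at h5
        have h6 := (mul_dvd_mul_iff_left (pow_ne_zero _ X_ne_zero)).mp h5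
        rw [X_dvd_iff, ← coeff_zero_eq_constantCoeff_apply] at h6
        exact h6
      · have := lowCoeffs_eq_zero_iff.mpr hd
        rw [map_sub, sub_eq_zero] at this
        exact this
  have h4 : Module.finrank k (S.jetSpace n I) = Module.finrank k ((S.jetSpace n I).map ρ) :=
    (Submodule.equivMapOfInjective ρ hρ _).finrank_eq
  have h5 : colength O (n + indicatorVec I) =
      Module.finrank k (↥(Subalgebra.toSubmodule O) ⧸ J) := colength_eq O _
  rw [h4, h3, h5, ← h2, norm₁, h1]

theorem jetSpace_insert {n : Fin d → ℕ} {I : Finset (Fin d)} (i₀ : Fin d) [DecidableEq (Fin d)]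
    {v : Fin d × Fin N → k} : v ∈ S.jetSpace n (insert i₀ I) ↔
      v ∈ S.jetSpace n I ∧ v (i₀, ⟨0, S.pos⟩) = 0 := by
  simp only [S.mem_jetSpace, Finset.mem_insert, forall_eq_or_imp]
  tauto

-- The coordinate `μ_{i₀}(0)` is a functional on the jet space: it is either zero or surjective, and
-- in the latter case its kernel has codimension one.
open Classical in
theorem finrank_jetSpace_insert (n : Fin d → ℕ) (I : Finset (Fin d)) (i₀ : Fin d) :
    Module.finrank k (S.jetSpace n I) = Module.finrank k (S.jetSpace n (insert i₀ I)) +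
      if ∃ v ∈ S.jetSpace n I, v (i₀, ⟨0, S.pos⟩) = 1 then 1 else 0 := by
  have hle : S.jetSpace n (insert i₀ I) ≤ S.jetSpace n I := fun v hv =>
    ((S.jetSpace_insert i₀).mp hv).1
  split_ifs with h
  · let f : Module.Dual k (S.jetSpace n I) :=
      LinearMap.proj (R := k) (φ := fun _ => k) (i₀, (⟨0, S.pos⟩ : Fin N)) ∘ₗ
        (S.jetSpace n I).subtype
    have hf : f ≠ 0 := by
      obtain ⟨v, hv, hv1⟩ := h
      intro h0
      have : f ⟨v, hv⟩ = 1 := hv1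
      rw [h0] at this
      exact zero_ne_one this
    have h1 := Module.Dual.finrank_ker_add_one_of_ne_zero hf
    rw [← h1]
    have h2 : LinearMap.ker f = (S.jetSpace n (insert i₀ I)).comap (S.jetSpace n I).subtype := by
      ext v
      rw [LinearMap.mem_ker, Submodule.mem_comap, S.jetSpace_insert]
      exact ⟨fun h => ⟨v.2, h⟩, fun h => h.2⟩
    rw [h2, (Submodule.comapSubtypeEquivOfLe hle).finrank_eq]
  · rw [add_zero]
    suffices heq : S.jetSpace n I = S.jetSpace n (insert i₀ I) by rw [← heq]
    refine le_antisymm (fun v hv => (S.jetSpace_insert i₀).mpr ⟨hv, ?_⟩) hle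
    by_contra h0
    exact h ⟨(v (i₀, ⟨0, S.pos⟩))⁻¹ • v, Submodule.smul_mem _ _ hv, by simp [h0]⟩

end JetSplitting
end Dimension

end CurveSing

namespace CurveSing

/-! ### The class of `ℐ_n` times that of the maximal ideal -/

namespace JetSplitting

variable {k : Type u} [Field k] {d N : ℕ} {O : Subalgebra k (Fin d → k⟦X⟧)} (S : JetSplitting O N)

/-- The linear map `μ ↦ p(t^n μ)` on jets, whose kernel is given by the condition `t^n μ ∈ 𝒪_A`. -/
noncomputable def obstruction (n : Fin d → ℕ) (A : Type u) [CommRing A] [Algebra k A] :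
    (Fin d × Fin N → A) →ₗ[A] (Fin d × Fin N → A) :=
  extendScalars A S.proj ∘ₗ jet A d N ∘ₗ LinearMap.mulLeft A (tPow A n) ∘ₗ ofJet A d N

theorem obstruction_algebraMap (n : Fin d → ℕ) (A : Type u) [CommRing A] [Algebra k A]
    (v : Fin d × Fin N → k) : S.obstruction n A (fun e => algebraMap k A (v e)) =
      fun e => algebraMap k A (S.obstruction n k v e) := by
  simp only [obstruction, LinearMap.comp_apply, LinearMap.mulLeft_apply]
  rw [← mapCoeff_ofJet, ← mapCoeff_tPow (algebraMap k A) n, ← map_mul, jet_mapCoeff,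
    extendScalars_algebraMap, extendScalars_self]

theorem obstruction_eq_zero_iff (n : Fin d → ℕ) {A : Type u} [CommRing A] [Algebra k A]
    (v : Fin d × Fin N → A) :
    S.obstruction n A v = 0 ↔ tPow A n * ofJet A d N v ∈ family O A := by
  rw [S.mem_family_iff]
  rfl

theorem mem_iff_proj_jet_eq_zero {z : Fin d → k⟦X⟧} : z ∈ O ↔ S.proj (jet k d N z) = 0 := by
  have h := S.conductor _ (ofJet_jet_sub_mem z)
  rw [S.proj_eq_zero]
  constructor
  · intro hz
    have := O.add_mem h hz
    rwa [sub_add_cancel] at this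
  · intro hz
    have := O.sub_mem hz h
    rwa [sub_sub_cancel] at this

theorem obstruction_self_eq_zero_iff (n : Fin d → ℕ) (v : Fin d × Fin N → k) :
    S.obstruction n k v = 0 ↔ tPow k n * ofJet k d N v ∈ O := by
  rw [S.mem_iff_proj_jet_eq_zero, ← extendScalars_self S.proj]
  rfl

/-- The jets `μ` with `t^n μ ∈ 𝒪_A` and `μ_{i₀}(0) = 1`. -/
def affineJets (n : Fin d → ℕ) (i₀ : Fin d) : PointSet k (Fin d × Fin N) := fun A _ _ =>
  {v | S.obstruction n A v = 0 ∧ v (i₀, ⟨0, S.pos⟩) = 1}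

open Classical in
theorem hasClass_affineJets (n : Fin d → ℕ) (i₀ : Fin d) (I : Finset (Fin d)) :
    HasClass (k := k)
      (fun A _ _ => {v | v ∈ S.affineJets n i₀ A ∧ ∀ i ∈ I, v (i, ⟨0, S.pos⟩) = 0})
      (if ∃ v ∈ S.jetSpace n I, v (i₀, ⟨0, S.pos⟩) = 1 then
        (affineLine k).cls₀ ^ Module.finrank k (S.jetSpace n (insert i₀ I)) else 0) := by
  let Θ : ∀ (A : Type u) [CommRing A] [Algebra k A],
      (Fin d × Fin N → A) →ₗ[A] ((Fin d × Fin N) ⊕ (Fin d ⊕ Unit) → A) := fun A _ _ =>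
    LinearMap.pi (Sum.elim (fun e => LinearMap.proj e ∘ₗ S.obstruction n A)
      (Sum.elim (fun i => if i ∈ I then LinearMap.proj (i, ⟨0, S.pos⟩) else 0)
        (fun _ => LinearMap.proj (i₀, ⟨0, S.pos⟩))))
  have hΘ : ∀ (A : Type u) [CommRing A] [Algebra k A] (v : Fin d × Fin N → k),
      Θ A (fun e => algebraMap k A (v e)) = fun e => algebraMap k A (Θ k v e) := by
    intro A _ _ v
    funext e
    rcases e with e | e | e
    · simp [Θ, obstruction_algebraMap]
    · by_cases he : e ∈ I <;> simp [Θ, he]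
    · simp [Θ]
  let b : (Fin d × Fin N) ⊕ (Fin d ⊕ Unit) → k := Sum.elim 0 (Sum.elim 0 1)
  -- The factor `c` treats both systems at once: `c = 0` describes the kernel, `c = 1` the
  -- inhomogeneous solutions.
  have hsol : ∀ (A : Type u) [CommRing A] [Algebra k A] (c : k) (v : Fin d × Fin N → A),
      (Θ A v = fun e => algebraMap k A (c * b e)) ↔ (S.obstruction n A v = 0 ∧
        v (i₀, ⟨0, S.pos⟩) = algebraMap k A c) ∧ ∀ i ∈ I, v (i, ⟨0, S.pos⟩) = 0 := by
    intro A _ _ c v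
    constructor
    · intro h
      refine ⟨⟨funext fun e => ?_, ?_⟩, fun i hi => ?_⟩
      · simpa [Θ, b] using congrFun h (.inl e)
      · simpa [Θ, b] using congrFun h (.inr (.inr ()))
      · simpa [Θ, b, hi] using congrFun h (.inr (.inl i))
    · rintro ⟨⟨h1, h2⟩, h3⟩
      funext e
      rcases e with e | e | e
      · simp [Θ, b, h1]
      · by_cases he : e ∈ I <;> simp [Θ, b, he, h3]
      · simp [Θ, b, h2]
  have hker : LinearMap.ker (Θ k) = S.jetSpace n (insert i₀ I) := by
    ext v
    have h := hsol k 0 v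
    rw [S.obstruction_self_eq_zero_iff] at h
    rw [LinearMap.mem_ker, S.jetSpace_insert, S.mem_jetSpace]
    have h0 : (fun e => algebraMap k k (0 * b e)) = 0 := by funext e; simp
    rw [h0] at h
    rw [h, map_zero]
    tauto
  have hb : b ∈ LinearMap.range (Θ k) ↔ ∃ v ∈ S.jetSpace n I, v (i₀, ⟨0, S.pos⟩) = 1 := by
    refine exists_congr fun v => ?_
    have h := hsol k 1 v
    rw [S.obstruction_self_eq_zero_iff] at h
    have h0 : (fun e => algebraMap k k (1 * b e)) = b := by funext e; simp
    rw [h0] at h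
    rw [h, S.mem_jetSpace, map_one]
    tauto
  have := hasClass_linearSystem Θ hΘ b
  rw [hker] at this
  simp only [hb] at this
  refine this.congr fun A _ _ => ?_
  ext v
  have h := hsol A 1 v
  simp only [one_mul, map_one] at h
  exact h

theorem hasClass_radical :
    HasClass S.radical ((affineLine k).cls₀ ^ Module.finrank k (S.jetSpace 0 Finset.univ)) := by
  let Θ : ∀ (A : Type u) [CommRing A] [Algebra k A],
      (Fin d × Fin N → A) →ₗ[A] ((Fin d × Fin N) ⊕ Fin d → A) := fun A _ _ =>
    LinearMap.pi (Sum.elim (fun e => LinearMap.proj e ∘ₗ extendScalars A S.proj)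
      (fun i => LinearMap.proj (i, ⟨0, S.pos⟩)))
  have hΘ : ∀ (A : Type u) [CommRing A] [Algebra k A] (v : Fin d × Fin N → k),
      Θ A (fun e => algebraMap k A (v e)) = fun e => algebraMap k A (Θ k v e) := by
    intro A _ _ v
    funext e
    rcases e with e | e
    · simp [Θ, extendScalars_algebraMap, extendScalars_self]
    · simp [Θ]
  have hsol : ∀ (A : Type u) [CommRing A] [Algebra k A] (v : Fin d × Fin N → A),
      Θ A v = 0 ↔ extendScalars A S.proj v = 0 ∧ ∀ i, v (i, ⟨0, S.pos⟩) = 0 := by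
    intro A _ _ v
    constructor
    · intro h
      exact ⟨funext fun e => congrFun h (.inl e), fun i => congrFun h (.inr i)⟩
    · rintro ⟨h1, h2⟩
      funext e
      rcases e with e | e
      · exact congrFun h1 e
      · exact h2 e
  have hker : LinearMap.ker (Θ k) = S.jetSpace 0 Finset.univ := by
    ext v
    have h1 : tPow k (0 : Fin d → ℕ) * ofJet k d N v = ofJet k d N v := by
      funext i
      simp [tPow]
    rw [LinearMap.mem_ker, hsol, S.mem_jetSpace, extendScalars_self, S.proj_eq_zero, h1]
    simp
  have := hasClass_linearSystem Θ hΘ 0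
  rw [hker, if_pos (zero_mem _)] at this
  refine this.congr fun A _ _ => ?_
  ext v
  have h0 : (fun e : (Fin d × Fin N) ⊕ Fin d => algebraMap k A ((0 : (Fin d × Fin N) ⊕ Fin d → k) e)) = 0 := by
    funext e; simp
  change (Θ A v = _) ↔ _
  rw [h0, hsol, and_comm]
  simp only [radical, ofJet_mem_tIdeal, Nat.lt_one_iff, Set.mem_ofPred_eq]
  refine and_congr_left fun _ => ⟨fun h i m hm => ?_, fun h i => h i _ rfl⟩
  have : m = ⟨0, S.pos⟩ := Fin.ext hm
  rw [this, h]

/-- The jets `μ` with `t^n μ ∈ 𝒪_A`, `μ_{i₀}(0) = 1` and `μ(0)` invertible. -/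
def unitJets (n : Fin d → ℕ) (i₀ : Fin d) : PointSet k (Fin d × Fin N) := fun A _ _ =>
  {v | (v ∈ S.affineJets n i₀ A ∧ ∀ i ∈ (∅ : Finset (Fin d)), v (i, ⟨0, S.pos⟩) = 0) ∧
    ∀ i ∈ Finset.univ.erase i₀, IsUnit (v (i, ⟨0, S.pos⟩))}

theorem mem_unitJets {n : Fin d → ℕ} {i₀ : Fin d} {A : Type u} [CommRing A] [Algebra k A]
    {v : Fin d × Fin N → A} : v ∈ S.unitJets n i₀ A ↔
      tPow A n * ofJet A d N v ∈ family O A ∧ v (i₀, ⟨0, S.pos⟩) = 1 ∧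
        ∀ i, IsUnit (v (i, ⟨0, S.pos⟩)) := by
  rw [← S.obstruction_eq_zero_iff]
  simp only [unitJets, affineJets, Finset.notMem_empty, false_imp_iff, implies_true, and_true,
    Finset.mem_erase, Finset.mem_univ, Set.mem_ofPred_eq, and_assoc]
  refine and_congr_right fun _ => and_congr_right fun h => ⟨fun h' i => ?_, fun h' i _ => h' i⟩
  by_cases hi : i = i₀
  · rw [hi, h]; exact isUnit_one
  · exact h' i hi

-- The coordinate at `i₀` is fixed to `1`, so only the hyperplanes with `i ≠ i₀` have to be removed.
open Classical in
theorem hasClass_unitJets (n : Fin d → ℕ) (i₀ : Fin d) :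
    HasClass (S.unitJets n i₀) (∑ I ∈ (Finset.univ.erase i₀).powerset, (-1) ^ I.card *
      (if ∃ v ∈ S.jetSpace n I, v (i₀, ⟨0, S.pos⟩) = 1 then
        (affineLine k).cls₀ ^ Module.finrank k (S.jetSpace n (insert i₀ I)) else 0)) := by
  have := hasClass_arrangement (fun i : Fin d => (i, (⟨0, S.pos⟩ : Fin N)))
    (S.hasClass_affineJets n i₀) (Finset.univ.erase i₀) ∅
  refine Eq.subst (motive := fun c => HasClass (S.unitJets n i₀) c)
    (Finset.sum_congr rfl fun I _ => ?_) this
  rw [Finset.empty_union]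

/-- Every jet `μ` in `unitJets` is uniquely a product of a normal form and an element of
`1 + 𝔪_A`. -/
theorem bijOn_mul [IsLocalRing O] (n : Fin d → ℕ) (i₀ : Fin d) (A : Type u) [CommRing A]
    [Algebra k A] :
    Set.BijOn (fun u : NormalFormIndex d N ⊕ (Fin d × Fin N) → A =>
        jet A d N (normalTuple (fun e => u (.inl e)) * (1 + ofJet A d N fun e => u (.inr e))))
      {u | (fun e => u (.inl e)) ∈ S.principalForms i₀ n A ∧ (fun e => u (.inr e)) ∈ S.radical A}
      (S.unitJets n i₀ A) := by
  refine ⟨?_, ?_, ?_⟩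
  · rintro u ⟨hv, hm⟩
    obtain ⟨hv, hv'⟩ := S.mem_principalForms.mp hv
    set v : NormalFormIndex d N → A := fun e => u (.inl e)
    set m : Fin d × Fin N → A := fun e => u (.inr e)
    have h0 : ∀ i, jet A d N (normalTuple v * (1 + ofJet A d N m)) (i, ⟨0, S.pos⟩) =
        v (.inl (.inl i)) := by
      intro i
      rw [jet_apply, coeff_zero_eq_constantCoeff_apply]
      simp [S.constantCoeff_normalTuple hv, mem_tIdeal_one.mp hm.1 i]
    refine S.mem_unitJets.mpr ⟨?_, (h0 i₀).trans hv.2.1, fun i => ?_⟩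
    · have h1 := S.tIdeal_le_family (Ideal.mul_mem_left _ (tPow A n)
        (ofJet_jet_sub_mem (N := N) (normalTuple v * (1 + ofJet A d N m))))
      have h2 := mul_mem hv' (add_mem (one_mem _) (S.ofJet_mem_family hm))
      have := add_mem h1 h2
      rwa [mul_assoc, mul_sub, sub_add_cancel] at this
    · exact (congrArg IsUnit (h0 i)).mpr (IsUnit.of_mul_eq_one _ (hv.1 i))
  · rintro u ⟨hv, hm⟩ u' ⟨hv', hm'⟩ huu
    obtain ⟨h1, h2⟩ := S.normalForm_unique hv.1 hv'.1 (S.ofJet_mem_family hm) hm.1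
      (S.ofJet_mem_family hm') hm'.1 (jet_eq_iff.mp huu)
    rw [← jet_eq_iff, jet_ofJet, jet_ofJet] at h2
    funext e
    rcases e with e | e
    · exact congrFun h1 e
    · exact congrFun h2 e
  · intro v hv
    obtain ⟨hv1, hv2, hv3⟩ := S.mem_unitJets.mp hv
    choose x hx using hv3
    have hc : ∀ i, constantCoeff (ofJet A d N v i) = x i := by
      intro i
      rw [← coeff_zero_eq_constantCoeff_apply, coeff_ofJet, dif_pos S.pos, hx]
    let w : Fin d → A⟦X⟧ := (fun i => C (↑(x i)⁻¹ : A)) * ofJet A d N v - 1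
    have hw : w ∈ tIdeal d A 1 := by
      rw [mem_tIdeal_one]
      intro i
      simp [w, hc]
    obtain ⟨s, hs, m, hm, hsm⟩ := S.exists_factorization hw
    let v' : NormalFormIndex d N → A :=
      Sum.elim (Sum.elim (fun i => (x i : A)) (fun i => (↑(x i)⁻¹ : A))) s
    have hv' : v' ∈ S.normalForms i₀ A := ⟨fun i => (x i).mul_inv, (hx i₀).trans hv2, hs⟩
    have h1 : normalTuple v' * (1 + ofJet A d N m) - ofJet A d N v ∈ tIdeal d A N := by
      have h2 : normalTuple v' * (1 + ofJet A d N m) - ofJet A d N v =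
          (fun i => C (x i : A)) * ((1 + ofJet A d N s) * (1 + ofJet A d N m) - (1 + w)) := by
        have h3 : (fun i => C (x i : A) : Fin d → A⟦X⟧) * (1 + w) = ofJet A d N v := by
          funext i
          simp only [w, add_sub_cancel, Pi.mul_apply]
          rw [← mul_assoc, ← map_mul, Units.mul_inv, map_one, one_mul]
        rw [mul_sub, h3, ← mul_assoc]
        rfl
      rw [h2]
      exact Ideal.mul_mem_left _ _ hsm
    have hm1 : 1 + ofJet A d N m ∈ family O A := add_mem (one_mem _) (S.ofJet_mem_family hm)
    obtain ⟨g, hg⟩ := isUnit_one_add hm.1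
    have hg' : (↑g⁻¹ : Fin d → A⟦X⟧) ∈ family O A :=
      S.inverse_mem_family hm1 (by rw [← hg, Units.mul_inv])
    -- The normal form inherits `t^n v' ∈ 𝒪_A` from the jet: divide by `1 + m`, whose inverse lies
    -- in `𝒪_A`, the error modulo `t^N` being absorbed by the conductor.
    refine ⟨Sum.elim v' m, ⟨S.mem_principalForms.mpr ⟨hv', ?_⟩, hm⟩, ?_⟩
    · have h4 := add_mem (S.tIdeal_le_family (Ideal.mul_mem_left _ (tPow A n) h1)) hv1
      rw [mul_sub, sub_add_cancel, ← mul_assoc] at h4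
      have h5 := mul_mem h4 hg'
      rwa [← hg, mul_assoc _ (g : Fin d → A⟦X⟧), Units.mul_inv, mul_one] at h5
    · have h6 := jet_eq_iff.mpr h1
      rw [jet_ofJet] at h6
      exact h6

-- Two computations of the class of the same functor `unitJets`: as a product through `bijOn_mul`,
-- and by inclusion-exclusion. The identity holds already in `K₀(Var_k)`.
open Classical in
theorem cls₀_mul_eq [IsLocalRing O] (n : Fin d → ℕ) (i₀ : Fin d) {c : K₀Var k}
    (hc : HasClass (S.principalForms i₀ n) c) :
    c * (affineLine k).cls₀ ^ Module.finrank k (S.jetSpace 0 Finset.univ) =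
      ∑ I ∈ (Finset.univ.erase i₀).powerset, (-1) ^ I.card *
        (if ∃ v ∈ S.jetSpace n I, v (i₀, ⟨0, S.pos⟩) = 1 then
          (affineLine k).cls₀ ^ Module.finrank k (S.jetSpace n (insert i₀ I)) else 0) := by
  refine ((hc.prod S.hasClass_radical).map _ ?_ (S.bijOn_mul n i₀)).unique
    (S.hasClass_unitJets n i₀)
  intro A A' _ _ _ _ φ u _
  change jet A' d N (normalTuple (fun e => φ.toRingHom (u (.inl e))) *
    (1 + ofJet A' d N fun e => φ.toRingHom (u (.inr e)))) = _
  rw [← mapCoeff_normalTuple, ← mapCoeff_ofJet, ← map_one (mapCoeff d φ.toRingHom), ← map_add,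
    ← map_mul, jet_mapCoeff]
  rfl

end JetSplitting

/-! ### The Laurent polynomial and its evaluation at `𝕃` -/

section Poincare

open LaurentPolynomial

variable {k : Type u} [Field k] {d N : ℕ} {O : Subalgebra k (Fin d → k⟦X⟧)}
  (S : JetSplitting O N)

open Classical in
/-- The Laurent polynomial `P` with `P(𝕃) = [ℐ_n]`. -/
noncomputable def JetSplitting.classPolynomial (n : Fin d → ℕ) (i₀ : Fin d) : ℤ[T;T⁻¹] :=
  ∑ I ∈ (Finset.univ.erase i₀).powerset, (-1) ^ I.card *
    (if ∃ v ∈ S.jetSpace n I, v (i₀, ⟨0, S.pos⟩) = 1 then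
      T ((Module.finrank k (S.jetSpace n (insert i₀ I)) : ℤ) -
        Module.finrank k (S.jetSpace 0 Finset.univ)) else 0)

/-- The dimension count turns the summand of `I` on the right into `±T^{D(I) - h}`; the subsets are
then paired as `I`, `I ∪ {i₀}`. -/
theorem JetSplitting.T_sub_one_mul_classPolynomial [IsLocalRing O]
    [Module.Finite k ((Fin d → k⟦X⟧) ⧸ Subalgebra.toSubmodule O)] (n : Fin d → ℕ) (i₀ : Fin d) :
    (T 1 - 1) * S.classPolynomial n i₀ = T ((norm₁ n : ℤ) + 1) *
      ∑ I : Finset (Fin d), (-1) ^ I.card * T (-(colength O (n + indicatorVec I) : ℤ)) := by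
  classical
  set h := Module.finrank k (S.jetSpace 0 Finset.univ) with hh
  have hD : ∀ I : Finset (Fin d), (T ((norm₁ n : ℤ) + 1) *
      ((-1) ^ I.card * T (-(colength O (n + indicatorVec I) : ℤ))) : ℤ[T;T⁻¹]) =
      (-1) ^ I.card * T ((Module.finrank k (S.jetSpace n I) : ℤ) - h) := by
    intro I
    rw [mul_left_comm, ← T_add]
    congr 2
    have h1 := S.finrank_jetSpace n I
    have h2 := S.finrank_jetSpace 0 Finset.univ
    rw [colength_maximal O i₀] at h2
    have h3 : norm₁ (0 : Fin d → ℕ) = 0 := by simp [norm₁]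
    omega
  have huniv : (Finset.univ : Finset (Finset (Fin d))) =
      (insert i₀ (Finset.univ.erase i₀)).powerset := by
    rw [Finset.insert_erase (Finset.mem_univ _), Finset.powerset_univ]
  rw [Finset.mul_sum, Finset.sum_congr rfl fun I _ => hD I, huniv,
    Finset.sum_powerset_insert (Finset.notMem_erase _ _), ← Finset.sum_add_distrib,
    JetSplitting.classPolynomial, Finset.mul_sum]
  refine Finset.sum_congr rfl fun I hI => ?_
  have hi : i₀ ∉ I := fun hi => Finset.notMem_erase i₀ _ (Finset.mem_powerset.mp hI hi)
  rw [Finset.card_insert_of_notMem hi, S.finrank_jetSpace_insert n I i₀, ← hh]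
  -- If the dimension drops by one, the pair contributes `T^{e+1} - T^e = (T - 1)T^e`; otherwise its
  -- two terms cancel.
  split_ifs with hex
  · have : (T (((Module.finrank k (S.jetSpace n (insert i₀ I)) + 1 : ℕ) : ℤ) - h) : ℤ[T;T⁻¹]) =
        T 1 * T ((Module.finrank k (S.jetSpace n (insert i₀ I)) : ℤ) - h) := by
      rw [← T_add]
      congr 1
      push_cast
      ring
    rw [this]
    ring
  · rw [add_zero]
    ring

/-- Only here is `𝕃` inverted, to cancel the factor `𝕃^h` contributed by the maximal ideal. -/
theorem JetSplitting.cls_eq_eval₂ [IsLocalRing O] (n : Fin d → ℕ) (i₀ : Fin d) {V : Variety k}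
    (hV : HasClass (S.principalForms i₀ n) V.cls₀) :
    V.cls = LaurentPolynomial.eval₂ (Int.castRingHom (MRing k)) (lefschetz k)
      (S.classPolynomial n i₀) := by
  classical
  have h := congrArg (algebraMap (K₀Var k) (MRing k)) (S.cls₀_mul_eq n i₀ hV)
  have hL : algebraMap (K₀Var k) (MRing k) (affineLine k).cls₀ = lefschetz k := rfl
  rw [map_mul, map_pow, hL, map_sum] at h
  set D := Module.finrank k (S.jetSpace 0 Finset.univ) with hD
  have hu : IsUnit ((lefschetz k : MRing k) ^ D) := (lefschetz k).isUnit.pow D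
  refine hu.mul_right_cancel (h.trans ?_)
  rw [JetSplitting.classPolynomial, map_sum, Finset.sum_mul]
  refine Finset.sum_congr rfl fun I _ => ?_
  rw [map_mul, map_mul, map_pow, map_pow, map_neg, map_neg, map_one, map_one, mul_assoc]
  congr 1
  split_ifs
  · rw [map_pow, hL, eval₂_T, ← hD, ← Units.val_pow_eq_pow_val, ← Units.val_pow_eq_pow_val,
      ← Units.val_mul, ← zpow_natCast, ← zpow_natCast, ← zpow_add, sub_add_cancel]
  · rw [map_zero, map_zero, zero_mul]

end Poincare

end CurveSing

open LaurentPolynomial in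
theorem proposition5 {k : Type u} [Field k] {d : ℕ}
    (O : Subalgebra k (Fin d → PowerSeries k)) [IsLocalRing O]
    [Module.Finite k ((Fin d → PowerSeries k) ⧸ Subalgebra.toSubmodule O)]
    (n : Fin d → ℕ) (hn : n ∈ CurveSing.valueSemigroup O) :
    Nonempty (CurveSing.JVariety O) ∧
    ∀ J : CurveSing.JVariety O,
      ∃ (hclosed : IsClosed (CurveSing.sigmaImage J n)) (P : ℤ[T;T⁻¹]),
        (T 1 - 1) * P = T ((CurveSing.norm₁ n : ℤ) + 1) *
          ∑ I : Finset (Fin d),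
            (-1) ^ I.card * T (-(CurveSing.colength O (n + CurveSing.indicatorVec I) : ℤ)) ∧
        (J.V.ofClosed (CurveSing.sigmaImage J n) hclosed).cls =
          LaurentPolynomial.eval₂ (Int.castRingHom (CurveSing.MRing k))
            (CurveSing.lefschetz k) P := by
  obtain ⟨N, ⟨S⟩⟩ := CurveSing.exists_jetSplitting O
  -- For `d = 0` the ring `𝒪` would be zero, which is not local.
  obtain ⟨i₀⟩ : Nonempty (Fin d) := by
    by_contra h
    rw [not_nonempty_iff] at h
    exact zero_ne_one (α := O) (Subtype.ext (Subsingleton.elim _ _))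
  refine ⟨S.nonempty_JVariety i₀, fun J => ?_⟩
  obtain ⟨hclosed, hc⟩ := S.exists_hasClass_sigmaImage i₀ J n
  exact ⟨hclosed, S.classPolynomial n i₀, S.T_sub_one_mul_classPolynomial n i₀,
    S.cls_eq_eval₂ n i₀ hc⟩
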